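/- Let $W$ be the Weyl group of type $D_n$ ($n\ge 4$) or of type $B_n$ ($n\ge 2$), given by its Coxeter presentation $W=\langle s_1,\dots,s_n \mid (s_is_j)^{m_{ij}}=1\rangle$, where $m_{ii}=1$ and, for $i\neq j$, $m_{ij}=2$ except that: in type $D_n$, $m_{i,i+1}=m_{i+1,i}=3$ for $1\le i\le n-2$ and $m_{n-2,n}=m_{n,n-2}=3$; in type $B_n$, $m_{i,i+1}=m_{i+1,i}=3$ for $1\le i\le n-2$ and $m_{n-1,n}=m_{n,n-1}=4$. Let $u\in\mathbb C$ and, in type $B_n$, also $v\in\mathbb C$. The degenerate affine Hecke-Clifford algebra $\mathfrak H_W$ is the unital associative $\mathbb C$-algebra generated by $x_i,c_i,s_i$ ($1\le i\le n$) subject to the above relations of $W$ on the $s_i$ and the following relations: - $c_i^2=1$, and $c_ic_j=-c_jc_i$ for $i\ne j$; - $x_ix_j=x_jx_i$, $x_ic_i=-c_ix_i$, and $x_ic_j=c_jx_i$ for $i\neq j$; - for $1\le i\le n-1$: $s_ic_j=c_{s_i(j)}s_i$ for all $j$ (with $s_i$ acting on indices as the transposition $(i,i+1)$), $x_{i+1}s_i-s_ix_i=u(1-c_{i+1}c_i)$,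 and $x_js_i=s_ix_j$ for $j\ne i,i+1$; - in type $D_n$: $s_nc_n=-c_{n-1}s_n$, $s_nx_n+x_{n-1}s_n=-u(1+c_{n-1}c_n)$, and $s_nc_i=c_is_n$, $s_nx_i=x_is_n$ for $i\neq n-1,n$; - in type $B_n$: $s_nc_n=-c_ns_n$, $s_nx_n+x_ns_n=-\sqrt2\,v$, and $s_nc_i=c_is_n$, $s_nx_i=x_is_n$ for $i\ne n$. Let $\mathbb C[\mathfrak h^*]=\mathbb C[x_1,\dots,x_n]$, and let $\mathcal C_n$ be the Clifford algebra generated by $c_1,\dots,c_n$ with $c_i^2=1$ and $c_ic_j=-c_jc_i$ ($i\ne j$). **Theorem.** The canonical homomorphisms from $\mathbb C[\mathfrak h^*]$, $\mathcal C_n$ and $\mathbb CW$ to $\mathfrak H_W$ are injective, so these are subalgebras, and multiplication induces a vector space isomorphism $$\mathbb C[\mathfrak h^*]\otimes\mathcal C_n\otimes\mathbb CW\;\xrightarrow{\ \simeq\ }\;\mathfrak H_W .$$ Equivalently, the elements $x^\alpha c^\epsilon w$ with $\alpha\in\mathbb Z_{\geq 0}^n$, $\epsilon\in\mathbb Z_2^n$,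 $w\in W$ form a linear basis of $\mathfrak H_W$, where $x^\alpha=x_1^{\alpha_1}\cdots x_n^{\alpha_n}$ and $c^\epsilon=c_1^{\epsilon_1}\cdots c_n^{\epsilon_n}$. -/

import Mathlib

open scoped TensorProduct

noncomputable section

namespace HeckeClifford

/-- The Coxeter matrix of type `D_n`. The usual labels `1, …, n` are shifted to `0, …, n - 1`:
the nodes `0, …, n - 2` form a chain, and the last node `n - 1` is joined (by an unmarked edge)
to the node `n - 3` only. -/
def coxeterD (n : ℕ) : CoxeterMatrix (Fin n) where
  M := Matrix.of fun i j : Fin n ↦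
    if i = j then 1
    else if ((i : ℕ) + 1 = j ∧ (j : ℕ) + 1 < n) ∨ ((j : ℕ) + 1 = i ∧ (i : ℕ) + 1 < n) ∨
        ((i : ℕ) + 2 = j ∧ (j : ℕ) + 1 = n) ∨ ((j : ℕ) + 2 = i ∧ (i : ℕ) + 1 = n) then 3
    else 2
  isSymm := by
    ext i j
    simp only [Matrix.transpose_apply, Matrix.of_apply]
    by_cases h : i = j
    · simp [h]
    · rw [if_neg h, if_neg (Ne.symm h)]
      congr 1
      apply propext
      tauto
  diagonal := by simp
  off_diagonal := by
    intro i j h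
    simp only [Matrix.of_apply, if_neg h]
    split_ifs <;> norm_num

/-- Names of the generators `x_i`, `c_i`, `s_i`. -/
inductive Gen (n : ℕ) : Type
  | x (i : Fin n)
  | c (i : Fin n)
  | s (i : Fin n)

/-- The free algebra on the symbols `x_i`, `c_i`, `s_i`. -/
abbrev Free (n : ℕ) : Type := FreeAlgebra ℂ (Gen n)

variable {n : ℕ}

/-- The free generator `x_i`. -/
abbrev fx (i : Fin n) : Free n := FreeAlgebra.ι ℂ (Gen.x i)

/-- The free generator `c_i`. -/
abbrev fc (i : Fin n) : Free n := FreeAlgebra.ι ℂ (Gen.c i)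

/-- The free generator `s_i`. -/
abbrev fs (i : Fin n) : Free n := FreeAlgebra.ι ℂ (Gen.s i)

/-- Defining relations of a degenerate affine Hecke-Clifford algebra: the Coxeter relations of the
matrix `M` on the `s_i`, the relations of type `A_{n-1}` on the `x_i`, the `c_i` and all `s_i`
but the last one, and further relations `E` (which involve the last `s_i`).
The relations `s_i c_j = c_{s_i(j)} s_i` for simple transpositions
amount to `σ c_j = c_{σ(j)} σ` for all permutations `σ`. -/
inductive Rel (u : ℂ) (M : CoxeterMatrix (Fin n)) (E : Free n → Free n → Prop) :
    Free n → Free n → Prop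
  | coxeter (i j : Fin n) : Rel u M E ((fs i * fs j) ^ (M i j)) 1
  | c_sq (i : Fin n) : Rel u M E (fc i * fc i) 1
  | c_anticomm (i j : Fin n) (h : i ≠ j) : Rel u M E (fc i * fc j) (-(fc j * fc i))
  | x_comm (i j : Fin n) : Rel u M E (fx i * fx j) (fx j * fx i)
  | x_c_same (i : Fin n) : Rel u M E (fx i * fc i) (-(fc i * fx i))
  | x_c_ne (i j : Fin n) (h : i ≠ j) : Rel u M E (fx i * fc j) (fc j * fx i)
  | s_c (i k : Fin n) (hk : (k : ℕ) = i + 1) (j : Fin n) :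
      Rel u M E (fs i * fc j) (fc (Equiv.swap i k j) * fs i)
  | x_s (i k : Fin n) (hk : (k : ℕ) = i + 1) :
      Rel u M E (fx k * fs i - fs i * fx i) (u • (1 - fc k * fc i))
  | x_s_comm (i k : Fin n) (hk : (k : ℕ) = i + 1) (j : Fin n) (hi : j ≠ i) (hj : j ≠ k) :
      Rel u M E (fx j * fs i) (fs i * fx j)
  | extra (a b : Free n) (h : E a b) : Rel u M E a b

/-- The additional relations in type `D_n`; `p` and `q` are the last but one and the last index
(`n - 1` and `n` in the usual labelling starting with `1`). -/
inductive RelD (u : ℂ) : Free n → Free n → Prop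
  | s_c_last (p q : Fin n) (hp : (p : ℕ) + 2 = n) (hq : (q : ℕ) + 1 = n) :
      RelD u (fs q * fc q) (-(fc p * fs q))
  | s_c_ne (q i : Fin n) (hq : (q : ℕ) + 1 = n) (hi : (i : ℕ) + 2 < n) :
      RelD u (fs q * fc i) (fc i * fs q)
  | s_x_last (p q : Fin n) (hp : (p : ℕ) + 2 = n) (hq : (q : ℕ) + 1 = n) :
      RelD u (fs q * fx q + fx p * fs q) (-(u • (1 + fc p * fc q)))
  | s_x_ne (q i : Fin n) (hq : (q : ℕ) + 1 = n) (hi : (i : ℕ) + 2 < n) :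
      RelD u (fs q * fx i) (fx i * fs q)

/-- The additional relations in type `B_n`; `q` is the last index. -/
inductive RelB (v : ℂ) : Free n → Free n → Prop
  | s_c_last (q : Fin n) (hq : (q : ℕ) + 1 = n) :
      RelB v (fs q * fc q) (-(fc q * fs q))
  | s_c_ne (q i : Fin n) (hq : (q : ℕ) + 1 = n) (hi : i ≠ q) :
      RelB v (fs q * fc i) (fc i * fs q)
  | s_x_last (q : Fin n) (hq : (q : ℕ) + 1 = n) :
      RelB v (fs q * fx q + fx q * fs q) (algebraMap ℂ (Free n) (-((Real.sqrt 2 : ℝ) : ℂ) * v))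
  | s_x_ne (q i : Fin n) (hq : (q : ℕ) + 1 = n) (hi : i ≠ q) :
      RelB v (fs q * fx i) (fx i * fs q)

/-- The algebra generated by `x_i`, `c_i`, `s_i` subject to the relations `Rel u M E`. -/
abbrev AHC (u : ℂ) (M : CoxeterMatrix (Fin n)) (E : Free n → Free n → Prop) : Type :=
  RingQuot (Rel u M E)

section General

variable (u : ℂ) (M : CoxeterMatrix (Fin n)) (E : Free n → Free n → Prop)

/-- The quotient map from the free algebra. -/
def mk : Free n →ₐ[ℂ] AHC u M E := RingQuot.mkAlgHom ℂ (Rel u M E)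

/-- The generator `x_i`. -/
def x (i : Fin n) : AHC u M E := mk u M E (fx i)

/-- The generator `c_i`. -/
def c (i : Fin n) : AHC u M E := mk u M E (fc i)

/-- The generator `s_i`. -/
def s (i : Fin n) : AHC u M E := mk u M E (fs i)

variable {u M E} in
theorem mk_eq {a b : Free n} (h : Rel u M E a b) : mk u M E a = mk u M E b :=
  RingQuot.mkAlgHom_rel ℂ h

theorem s_pow (i j : Fin n) : (s u M E i * s u M E j) ^ (M i j) = 1 := by
  simpa [s] using mk_eq (Rel.coxeter (u := u) (M := M) (E := E) i j)

theorem c_mul_self (i : Fin n) : c u M E i * c u M E i = 1 := by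
  simpa [c] using mk_eq (Rel.c_sq (u := u) (M := M) (E := E) i)

theorem c_mul_c {i j : Fin n} (h : i ≠ j) :
    c u M E i * c u M E j = -(c u M E j * c u M E i) := by
  simpa [c] using mk_eq (Rel.c_anticomm (u := u) (M := M) (E := E) i j h)

theorem x_commute (i j : Fin n) : Commute (x u M E i) (x u M E j) := by
  simpa [x, Commute, SemiconjBy] using mk_eq (Rel.x_comm (u := u) (M := M) (E := E) i j)

/-- The ordered monomial `x^α = x_1^{α_1} ⋯ x_n^{α_n}`. -/
def xPow (α : Fin n →₀ ℕ) : AHC u M E := (List.ofFn fun i ↦ x u M E i ^ α i).prod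

/-- The ordered monomial `c^ε = c_1^{ε_1} ⋯ c_n^{ε_n}`. -/
def cPow (ε : Fin n → ZMod 2) : AHC u M E := (List.ofFn fun i ↦ c u M E i ^ (ε i).val).prod

theorem prod_ofFn_mul {A : Type*} [Monoid A] : ∀ {m : ℕ} (f g : Fin m → A),
    (∀ i j, Commute (f i) (g j)) →
    (List.ofFn fun i ↦ f i * g i).prod = (List.ofFn f).prod * (List.ofFn g).prod
  | 0, _, _, _ => by simp
  | m + 1, f, g, h => by
    have ih := prod_ofFn_mul (fun i : Fin m ↦ f i.succ) (fun i ↦ g i.succ)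
      (fun i j ↦ h _ _)
    have hc : Commute (List.ofFn fun i : Fin m ↦ f i.succ).prod (g 0) := by
      refine Commute.list_prod_left _ _ ?_
      intro y hy
      obtain ⟨i, rfl⟩ := (List.mem_ofFn' _ _).1 hy
      exact h _ _
    simp only [List.ofFn_succ, List.prod_cons]
    rw [ih]
    simp only [mul_assoc]
    rw [← mul_assoc (g 0), ← hc.eq, mul_assoc]

/-- The algebra homomorphism `ℂ[x_1, …, x_n] → AHC` with `x_i ↦ x_i`. -/
def polyHom : MvPolynomial (Fin n) ℂ →ₐ[ℂ] AHC u M E :=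
  AddMonoidAlgebra.lift ℂ (AHC u M E) (Fin n →₀ ℕ)
    { toFun := fun α ↦ xPow u M E α.toAdd
      map_one' := by simp [xPow]
      map_mul' := fun α β ↦ by
        simp only [xPow, toAdd_mul, Finsupp.add_apply, pow_add]
        exact prod_ofFn_mul _ _ fun i j ↦ ((x_commute u M E i j).pow_pow _ _) }

/-- The quadratic form `∑ z_i ^ 2` on `ℂ^n`. -/
def stdForm (n : ℕ) : QuadraticForm ℂ (Fin n → ℂ) :=
  QuadraticMap.weightedSumSquares ℂ (fun _ : Fin n ↦ (1 : ℂ))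

/-- The Clifford algebra `C_n`: its generators `c_i` (the images of the standard basis vectors)
satisfy `c_i ^ 2 = 1` and `c_i c_j = - c_j c_i` for `i ≠ j`. -/
abbrev Cliff (n : ℕ) : Type := CliffordAlgebra (stdForm n)

/-- The algebra homomorphism `C_n → AHC` with `c_i ↦ c_i`. -/
def cliffHom : Cliff n →ₐ[ℂ] AHC u M E :=
  CliffordAlgebra.lift (stdForm n)
    ⟨Fintype.linearCombination ℂ (c u M E), by
      intro z
      have h2 : (2 : ℂ) • ((∑ i, z i • c u M E i) * (∑ i, z i • c u M E i)) =
          (2 : ℂ) • algebraMap ℂ (AHC u M E) (∑ i, z i * z i) := by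
        rw [two_smul]
        conv_lhs => rw [Finset.sum_mul_sum]
        conv_lhs =>
          congr
          · skip
          · rw [Finset.sum_comm]
        rw [← Finset.sum_add_distrib]
        simp_rw [← Finset.sum_add_distrib]
        rw [map_sum, Finset.smul_sum]
        refine Finset.sum_congr rfl fun i _ ↦ ?_
        rw [Finset.sum_eq_single i]
        · rw [smul_mul_smul_comm, c_mul_self, ← two_smul ℂ, Algebra.algebraMap_eq_smul_one]
        · intro j _ hj
          rw [smul_mul_smul_comm, smul_mul_smul_comm, c_mul_c u M E hj, mul_comm (z j)]
          simp
        · simp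
      have h3 := smul_right_injective (AHC u M E) (two_ne_zero' ℂ) h2
      simpa [Fintype.linearCombination_apply, stdForm,
        QuadraticMap.weightedSumSquares_apply] using h3⟩

/-- The monoid homomorphism `W → AHC` with `s_i ↦ s_i`, where `W` is the Coxeter group of `M`. -/
def weylHom : M.Group →* AHC u M E :=
  M.toCoxeterSystem.lift ⟨s u M E, s_pow u M E⟩

/-- The algebra homomorphism `ℂW → AHC` with `s_i ↦ s_i`. -/
def groupHom : MonoidAlgebra ℂ M.Group →ₐ[ℂ] AHC u M E :=
  MonoidAlgebra.lift ℂ (AHC u M E) M.Group (weylHom u M E)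

/-- The PBW property: the canonical maps from `ℂ[x_1, …, x_n]`, `C_n` and `ℂW` are injective (so
these are subalgebras), multiplication is a linear isomorphism from their tensor product,
and the elements `x^α c^ε w` form a linear basis. -/
def HasPBW : Prop :=
  (Function.Injective (polyHom u M E) ∧ Function.Injective (cliffHom u M E) ∧
    Function.Injective (groupHom u M E)) ∧
  (∃ e : (MvPolynomial (Fin n) ℂ ⊗[ℂ] Cliff n ⊗[ℂ] MonoidAlgebra ℂ M.Group) ≃ₗ[ℂ] AHC u M E,
    ∀ (f : MvPolynomial (Fin n) ℂ) (a : Cliff n) (b : MonoidAlgebra ℂ M.Group),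
      e (f ⊗ₜ[ℂ] a ⊗ₜ[ℂ] b) = polyHom u M E f * cliffHom u M E a * groupHom u M E b) ∧
  (∃ B : Module.Basis ((Fin n →₀ ℕ) × (Fin n → ZMod 2) × M.Group) ℂ (AHC u M E),
    ∀ (α : Fin n →₀ ℕ) (ε : Fin n → ZMod 2) (w : M.Group),
      B (α, ε, w) = xPow u M E α * cPow u M E ε * weylHom u M E w)

end General

end HeckeClifford

end

/-! Spanning: with `a` in the subalgebra generated by the `x_i` and `c_i`, the relations give `s_i a
= b s_i + d` with `b`, `d` in the same subalgebra. Hence the span of the products `a w` with `w ∈ W`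
is a left ideal containing `1`, and each `a` is a combination of ordered monomials `x^α c^ε`
(`span_pbwMonomial`).

Independence: a representation is built on the space `OddAlg n ⊗ ℂW`, written `M.Group →₀ OddAlg n`.
The algebra `OddAlg n` has pairwise anticommuting generators `c_i`, `z_i` with `c_i ^ 2 = 1`, and
`x_i = c_i z_i`. A simple reflection acts by `p ⊗ w ↦ σ(p) ⊗ s w + D(p) ⊗ w`, where `σ` is the
signed transposition of the generators (the sign falls on the `c_i` only) and `D` is a `σ`-skew
derivation that kills every `c_k` and sends `z_a` and `z_b` to a multiple of the root `c_a - η c_b`.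
Then `D(x_k) = σ(c_k) D(z_k)` is quadratic in the `c_i` (constant for the last node in type `B_n`)
and reproduces the inhomogeneous terms of the relations between `s_i` and `x_k`.

The reason for using `z_i` instead of `x_i` is that `D` maps the linear span of the generators into
the span of the `c_k`, where every `D` vanishes. On generators, any word with two derivations is
therefore zero. The difference of the two sides of a braid relation is twisted-linear over `OddAlg
n` and kills every `1 ⊗ w`, so it vanishes (`ReflData.eq_zero_of_twist`); twisted-linearity needs
checking on generators only (`ReflData.op_comm`, `ReflData.op_braid_three`,
`ReflData.op_braid_four`).

Applied to `1 ⊗ 1`, the monomial `x^α c^ε w` gives `x^α c^ε ⊗ w`. These vectors are independent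
because `OddAlg n` acts on Clifford-valued polynomials in such a way that its ordered monomials send
a vacuum vector to nonzero multiples of distinct basis vectors (`polyRep_oddMonomial`). -/

noncomputable section

namespace HeckeClifford

variable {n : ℕ}

/-! ### Ordered monomials in anticommuting involutions, and the Clifford algebra. -/

section Spanning

variable {A : Type*} [Ring A]

/-- Left multiplication by a Clifford generator permutes the ordered monomials up to sign. -/
theorem mul_ofFn_pow : ∀ {m : ℕ} (f : Fin m → A), (∀ i, f i * f i = 1) →
    (∀ i j, i ≠ j → f i * f j = -(f j * f i)) → ∀ (i : Fin m) (ε : Fin m → ZMod 2),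
    ∃ ε' : Fin m → ZMod 2,
      f i * (List.ofFn fun k ↦ f k ^ (ε k).val).prod = (List.ofFn fun k ↦ f k ^ (ε' k).val).prod ∨
      f i * (List.ofFn fun k ↦ f k ^ (ε k).val).prod =
        -(List.ofFn fun k ↦ f k ^ (ε' k).val).prod
  | 0, _, _, _, i, _ => i.elim0
  | m + 1, f, hsq, hac, i, ε => by
    have hz : ∀ z : ZMod 2, z = 0 ∨ z = 1 := by decide
    induction i using Fin.cases with
    | zero =>
      refine ⟨Fin.cons (ε 0 + 1) fun k ↦ ε k.succ, Or.inl ?_⟩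
      simp only [List.ofFn_succ, List.prod_cons, Fin.cons_zero, Fin.cons_succ]
      rw [← mul_assoc]
      congr 1
      rcases hz (ε 0) with h | h
      · rw [h]; simp [ZMod.val_one]
      · rw [h, show (1 + 1 : ZMod 2) = 0 from rfl]; simp [ZMod.val_one, hsq]
    | succ i =>
      obtain ⟨ε', h'⟩ := mul_ofFn_pow (fun k : Fin m ↦ f k.succ) (fun k ↦ hsq _)
        (fun k l h ↦ hac _ _ fun e ↦ h (Fin.succ_injective _ e)) i (fun k ↦ ε k.succ)
      refine ⟨Fin.cons (ε 0) ε', ?_⟩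
      simp only [List.ofFn_succ, List.prod_cons, Fin.cons_zero, Fin.cons_succ]
      rcases hz (ε 0) with h | h
      · rw [h]
        simpa using h'
      · rw [h, ZMod.val_one, pow_one, ← mul_assoc, hac _ _ (Fin.succ_ne_zero i), neg_mul,
          mul_assoc]
        rcases h' with h' | h' <;> rw [h']
        · exact Or.inr rfl
        · left; simp

variable [Algebra ℂ A]

/-- A submodule containing `1` and stable under left multiplication by a set contains the
subalgebra generated by this set. -/
theorem mem_of_mem_adjoin {t : Set A} {S : Submodule ℂ A} (h1 : 1 ∈ S)
    (h : ∀ g ∈ t, ∀ y ∈ S, g * y ∈ S) {a : A} (ha : a ∈ Algebra.adjoin ℂ t) : a ∈ S := by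
  suffices H : ∀ y ∈ S, a * y ∈ S by simpa using H 1 h1
  induction ha using Algebra.adjoin_induction with
  | mem g hg => exact h g hg
  | algebraMap r =>
    intro y hy
    rw [← Algebra.smul_def]
    exact S.smul_mem r hy
  | add p q _ _ hp hq =>
    intro y hy
    rw [add_mul]
    exact S.add_mem (hp y hy) (hq y hy)
  | mul p q _ _ hp hq =>
    intro y hy
    rw [mul_assoc]
    exact hp _ (hq y hy)

theorem mul_mem_span_ofFn_pow (f : Fin n → A) (hsq : ∀ i, f i * f i = 1)
    (hac : ∀ i j, i ≠ j → f i * f j = -(f j * f i)) (i : Fin n) {y : A}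
    (hy : y ∈ Submodule.span ℂ (Set.range fun ε : Fin n → ZMod 2 ↦
      (List.ofFn fun k ↦ f k ^ (ε k).val).prod)) :
    f i * y ∈ Submodule.span ℂ (Set.range fun ε : Fin n → ZMod 2 ↦
      (List.ofFn fun k ↦ f k ^ (ε k).val).prod) := by
  induction hy using Submodule.span_induction with
  | mem y hy =>
    obtain ⟨ε, rfl⟩ := hy
    obtain ⟨ε', h | h⟩ := mul_ofFn_pow f hsq hac i ε <;> beta_reduce <;> rw [h]
    · exact Submodule.subset_span ⟨ε', rfl⟩
    · exact Submodule.neg_mem _ (Submodule.subset_span ⟨ε', rfl⟩)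
  | zero => simp
  | add p q _ _ hp hq => rw [mul_add]; exact Submodule.add_mem _ hp hq
  | smul r p _ hp => rw [mul_smul_comm]; exact Submodule.smul_mem _ r hp

end Spanning

/-- The generators of the Clifford algebra. -/
def cliffGen (i : Fin n) : Cliff n := CliffordAlgebra.ι (stdForm n) (Pi.single i 1)

theorem cliffGen_mul_self (i : Fin n) : cliffGen i * cliffGen i = 1 := by
  rw [cliffGen, CliffordAlgebra.ι_sq_scalar]
  have h : stdForm n (Pi.single i 1) = 1 := by
    simp [stdForm, QuadraticMap.weightedSumSquares_apply, Pi.single_apply]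
  rw [h, map_one]

theorem cliffGen_mul (i j : Fin n) (h : i ≠ j) :
    cliffGen i * cliffGen j = -(cliffGen j * cliffGen i) := by
  rw [eq_neg_iff_add_eq_zero, cliffGen, cliffGen, CliffordAlgebra.ι_mul_ι_add_swap,
    QuadraticMap.polar]
  have : ∀ k : Fin n, ((Pi.single i 1 : Fin n → ℂ) k + (Pi.single j 1 : Fin n → ℂ) k) *
      ((Pi.single i 1 : Fin n → ℂ) k + (Pi.single j 1 : Fin n → ℂ) k) =
      (Pi.single i 1 : Fin n → ℂ) k * (Pi.single i 1 : Fin n → ℂ) k +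
      (Pi.single j 1 : Fin n → ℂ) k * (Pi.single j 1 : Fin n → ℂ) k := by
    intro k
    rcases eq_or_ne k i with rfl | hi
    · simp [h]
    · simp [Pi.single_apply, hi]
  have h0 : stdForm n (Pi.single i 1 + Pi.single j 1) - stdForm n (Pi.single i 1) -
      stdForm n (Pi.single j 1) = 0 := by
    simp [stdForm, QuadraticMap.weightedSumSquares_apply, this, Finset.sum_add_distrib]
  rw [h0, map_zero]

/-- The ordered monomials in the Clifford generators. -/
def cliffPow (ε : Fin n → ZMod 2) : Cliff n := (List.ofFn fun i ↦ cliffGen i ^ (ε i).val).prod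

/-- Only spanning is needed here: independence of these monomials is pulled back along `cliffHom` in
`hasPBW_of_basis`. -/
theorem span_cliffPow : Submodule.span ℂ (Set.range (cliffPow (n := n))) = ⊤ := by
  rw [eq_top_iff]
  intro a _
  have ha : a ∈ Algebra.adjoin ℂ (Set.range (CliffordAlgebra.ι (stdForm n))) := by
    rw [CliffordAlgebra.adjoin_range_ι]; trivial
  have h1 : (1 : Cliff n) ∈ Submodule.span ℂ (Set.range (cliffPow (n := n))) :=
    Submodule.subset_span ⟨0, by simp [cliffPow]⟩
  refine mem_of_mem_adjoin h1 ?_ ha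
  rintro _ ⟨v, rfl⟩ y hy
  have hv : v = ∑ i, v i • (Pi.single i 1 : Fin n → ℂ) := by
    ext k; simp [Finset.sum_apply, Pi.single_apply]
  rw [hv, map_sum, Finset.sum_mul]
  refine Submodule.sum_mem _ fun i _ ↦ ?_
  rw [map_smul, smul_mul_assoc]
  exact Submodule.smul_mem _ _ (mul_mem_span_ofFn_pow _ cliffGen_mul_self cliffGen_mul i hy)

/-! ### From a basis of PBW monomials to the full PBW property. -/

section General

variable (u : ℂ) (M : CoxeterMatrix (Fin n)) (E : Free n → Free n → Prop)

theorem cliffHom_cliffPow (ε : Fin n → ZMod 2) :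
    cliffHom u M E (cliffPow ε) = cPow u M E ε := by
  have h : ∀ i, cliffHom u M E (cliffGen i) = c u M E i := fun i ↦ by
    rw [cliffGen, cliffHom, CliffordAlgebra.lift_ι_apply]
    simp
  simp [cliffPow, cPow, map_list_prod, List.map_ofFn, Function.comp_def, h]

theorem polyHom_monomial (α : Fin n →₀ ℕ) :
    polyHom u M E (MvPolynomial.monomial α 1) = xPow u M E α := by
  refine (AddMonoidAlgebra.lift_single _ _ _).trans ?_
  simp

theorem groupHom_single (w : M.Group) :
    groupHom u M E (MonoidAlgebra.single w 1) = weylHom u M E w := by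
  simp [groupHom, MonoidAlgebra.lift_single]

/-- The PBW monomials. -/
def pbwMonomial (p : (Fin n →₀ ℕ) × (Fin n → ZMod 2) × M.Group) : AHC u M E :=
  xPow u M E p.1 * cPow u M E p.2.1 * weylHom u M E p.2.2

/-- A linear map sending a basis to a linearly independent family is injective. -/
theorem injective_of_basis {ι V V' : Type*} [AddCommGroup V] [Module ℂ V] [AddCommGroup V']
    [Module ℂ V'] (b : Module.Basis ι ℂ V) (f : V →ₗ[ℂ] V') (h : LinearIndependent ℂ (f ∘ b)) :
    Function.Injective f := by
  rw [← LinearMap.ker_eq_bot, LinearMap.ker_eq_bot']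
  intro m hm
  have := b.linearCombination_repr m
  rw [← this, Finsupp.apply_linearCombination] at hm
  rw [linearIndependent_iff] at h
  exact b.repr.map_eq_zero_iff.1 (h _ hm)

theorem xPow_zero : xPow u M E 0 = 1 := by simp [xPow]

theorem cPow_zero : cPow u M E 0 = 1 := by simp [cPow]

/-- Each of the three factors has a basis that maps to a subfamily of the PBW monomials, which gives
the injectivity statements. The product basis of the tensor product corresponds bijectively to the
PBW basis, and the resulting linear isomorphism agrees with multiplication because both are linear
and agree on the basis. -/
theorem hasPBW_of_basis (hli : LinearIndependent ℂ (pbwMonomial u M E))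
    (hsp : ⊤ ≤ Submodule.span ℂ (Set.range (pbwMonomial u M E))) : HasPBW u M E := by
  have hx : LinearIndependent ℂ (xPow u M E) := by
    have := hli.comp (fun α : Fin n →₀ ℕ ↦ (α, (0 : Fin n → ZMod 2), (1 : M.Group)))
      fun a b h ↦ congrArg Prod.fst h
    convert! this using 1
    ext α
    simp [pbwMonomial, cPow_zero]
  have hc : LinearIndependent ℂ (cPow u M E) := by
    have := hli.comp (fun ε : Fin n → ZMod 2 ↦ ((0 : Fin n →₀ ℕ), ε, (1 : M.Group)))
      fun a b h ↦ congrArg (fun p ↦ p.2.1) h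
    convert! this using 1
    ext ε
    simp [pbwMonomial, xPow_zero]
  have hw : LinearIndependent ℂ (weylHom u M E) := by
    have := hli.comp (fun w : M.Group ↦ ((0 : Fin n →₀ ℕ), (0 : Fin n → ZMod 2), w))
      fun a b h ↦ congrArg (fun p ↦ p.2.2) h
    convert! this using 1
    ext ε
    simp [pbwMonomial, xPow_zero, cPow_zero]
  have hcl : LinearIndependent ℂ (cliffPow (n := n)) := by
    refine LinearIndependent.of_comp (cliffHom u M E).toLinearMap ?_
    convert! hc using 1
    ext ε
    exact cliffHom_cliffPow u M E ε
  let bP := MvPolynomial.basisMonomials (Fin n) ℂ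
  let bC : Module.Basis (Fin n → ZMod 2) ℂ (Cliff n) := Module.Basis.mk hcl span_cliffPow.ge
  let bG := MonoidAlgebra.basis M.Group ℂ
  have hbP : ∀ α, polyHom u M E (bP α) = xPow u M E α := fun α ↦ by
    rw [show bP α = MvPolynomial.monomial α 1 by simp [bP], polyHom_monomial]
  have hbC : ∀ ε, cliffHom u M E (bC ε) = cPow u M E ε := fun ε ↦ by
    simp only [bC, Module.Basis.mk_apply, cliffHom_cliffPow]
  have hbG : ∀ w, groupHom u M E (bG w) = weylHom u M E w := fun w ↦ by
    rw [show bG w = MonoidAlgebra.single w 1 by simp [bG], groupHom_single]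
  let B := Module.Basis.mk hli hsp
  have hB : ∀ α ε w, B (α, ε, w) = xPow u M E α * cPow u M E ε * weylHom u M E w := fun α ε w ↦ by
    simp only [B, Module.Basis.mk_apply, pbwMonomial]
  refine ⟨⟨?_, ?_, ?_⟩, ⟨((bP.tensorProduct bC).tensorProduct bG).equiv B
    (Equiv.prodAssoc _ _ _), ?_⟩, B, hB⟩
  · refine injective_of_basis bP (polyHom u M E).toLinearMap ?_
    convert! hx using 1
    ext α
    exact hbP α
  · refine injective_of_basis bC (cliffHom u M E).toLinearMap ?_
    convert! hc using 1
    ext α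
    exact hbC α
  · refine injective_of_basis bG (groupHom u M E).toLinearMap ?_
    convert! hw using 1
    ext α
    exact hbG α
  · set e := ((bP.tensorProduct bC).tensorProduct bG).equiv B (Equiv.prodAssoc _ _ _) with he
    have key : e.toLinearMap = TensorProduct.lift
        ((LinearMap.mul ℂ (AHC u M E)).compl₁₂
          (TensorProduct.lift ((LinearMap.mul ℂ (AHC u M E)).compl₁₂
            (polyHom u M E).toLinearMap (cliffHom u M E).toLinearMap))
          (groupHom u M E).toLinearMap) := by
      refine ((bP.tensorProduct bC).tensorProduct bG).ext ?_
      rintro ⟨⟨α, ε⟩, w⟩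
      rw [LinearEquiv.coe_coe, he, Module.Basis.equiv_apply]
      simp [Module.Basis.tensorProduct_apply, hB, hbP, hbC, hbG]
    intro f a b
    have := LinearMap.congr_fun key (f ⊗ₜ[ℂ] a ⊗ₜ[ℂ] b)
    simpa using this

end General

/-! ### Spanning: moving the `s_i` to the right. -/

section Prod

/-- The ordered product of a family with only one factor different from `1`. -/
theorem prod_ofFn_ite {A : Type*} [Monoid A] : ∀ {m : ℕ} (f : Fin m → A) (i : Fin m),
    (List.ofFn fun k ↦ if i = k then f k else 1).prod = f i
  | 0, _, i => i.elim0
  | m + 1, f, i => by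
    simp only [List.ofFn_succ, List.prod_cons]
    induction i using Fin.cases with
    | zero => simp [(Fin.succ_ne_zero _).symm, List.ofFn_const]
    | succ i =>
      have := prod_ofFn_ite (fun k : Fin m ↦ f k.succ) i
      simpa [Fin.succ_ne_zero] using this

variable {A : Type*} [Ring A]

theorem pow_comm_or_anticomm {a b : A} (h : a * b = b * a ∨ a * b = -(b * a)) (m : ℕ) :
    a * b ^ m = b ^ m * a ∨ a * b ^ m = -(b ^ m * a) := by
  induction m with
  | zero => simp
  | succ m ih =>
    rcases h with h | h <;> rcases ih with ih | ih <;>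
      simp only [pow_succ, ← mul_assoc, ih, neg_mul] <;>
      simp only [mul_assoc, h, mul_neg, neg_neg] <;> simp

theorem list_prod_comm_or_anticomm (a : A) (l : List A)
    (h : ∀ b ∈ l, a * b = b * a ∨ a * b = -(b * a)) :
    a * l.prod = l.prod * a ∨ a * l.prod = -(l.prod * a) := by
  induction l with
  | nil => simp
  | cons b l ih =>
    rcases h b (by simp) with hb | hb <;>
      rcases ih (fun b' hb' ↦ h b' (by simp [hb'])) with hl | hl <;>
      simp only [List.prod_cons, ← mul_assoc, hb, neg_mul] <;>
      simp only [mul_assoc, hl, mul_neg, neg_neg] <;> simp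

/-- Signs do not affect membership in a submodule, so the four sign patterns are treated alike. -/
theorem mul_mul_mem_of_anticomm [Algebra ℂ A] {S : Submodule ℂ A} {a b d d' : A}
    (h : a * b = b * a ∨ a * b = -(b * a)) (h' : a * d = d' ∨ a * d = -d') (hm : b * d' ∈ S) :
    a * (b * d) ∈ S := by
  rcases h with h | h <;> rcases h' with h' | h' <;>
    simp only [← mul_assoc, h, neg_mul] <;>
    simp only [mul_assoc, h', mul_neg, neg_neg, Submodule.neg_mem_iff, hm]

/-- Conjugation by `r` exchanges `p` and `q`; this supplies the last hypothesis of `exchange_conj`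
for the term `u (1 - c_k c_i)`. -/
theorem mul_neg_smul_one_sub [Algebra ℂ A] {u : ℂ} {r p q : A} (h1 : r * p = q * r)
    (h2 : r * q = p * r) : r * -(u • (1 - p * q)) = -(u • (1 - q * p)) * r := by
  rw [mul_neg, mul_smul_comm, mul_sub, ← mul_assoc, h1, mul_assoc, h2]
  simp only [neg_mul, smul_mul_assoc, sub_mul, mul_assoc, one_mul, mul_one]

end Prod

section General

variable (u : ℂ) (M : CoxeterMatrix (Fin n)) (E : Free n → Free n → Prop)

theorem s_mul_self (i : Fin n) : s u M E i * s u M E i = 1 := by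
  simpa using s_pow u M E i i

theorem x_c_same (i : Fin n) : x u M E i * c u M E i = -(c u M E i * x u M E i) := by
  simpa [x, c] using mk_eq (Rel.x_c_same (u := u) (M := M) (E := E) i)

theorem x_c_ne {i j : Fin n} (h : i ≠ j) : x u M E i * c u M E j = c u M E j * x u M E i := by
  simpa [x, c] using mk_eq (Rel.x_c_ne (u := u) (M := M) (E := E) i j h)

theorem s_c (i k : Fin n) (hk : (k : ℕ) = i + 1) (j : Fin n) :
    s u M E i * c u M E j = c u M E (Equiv.swap i k j) * s u M E i := by
  simpa [s, c] using mk_eq (Rel.s_c (u := u) (M := M) (E := E) i k hk j)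

theorem x_s (i k : Fin n) (hk : (k : ℕ) = i + 1) :
    x u M E k * s u M E i - s u M E i * x u M E i = u • (1 - c u M E k * c u M E i) := by
  simpa [s, c, x] using mk_eq (Rel.x_s (u := u) (M := M) (E := E) i k hk)

theorem x_s_comm (i k : Fin n) (hk : (k : ℕ) = i + 1) (j : Fin n) (hi : j ≠ i) (hj : j ≠ k) :
    x u M E j * s u M E i = s u M E i * x u M E j := by
  simpa [s, c, x] using mk_eq (Rel.x_s_comm (u := u) (M := M) (E := E) i k hk j hi hj)

theorem adjoin_x_c_s : Algebra.adjoin ℂ (Set.range (x u M E) ∪ Set.range (c u M E) ∪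
    Set.range (s u M E)) = ⊤ := by
  rw [eq_top_iff]
  rintro a -
  obtain ⟨a, rfl⟩ := RingQuot.mkAlgHom_surjective ℂ (Rel u M E) a
  induction a using FreeAlgebra.induction with
  | grade0 r => rw [AlgHom.commutes]; exact Subalgebra.algebraMap_mem _ r
  | grade1 g =>
    apply Algebra.subset_adjoin
    cases g with
    | x i => exact Or.inl (Or.inl ⟨i, rfl⟩)
    | c i => exact Or.inl (Or.inr ⟨i, rfl⟩)
    | s i => exact Or.inr ⟨i, rfl⟩
  | mul p q hp hq => rw [map_mul]; exact Subalgebra.mul_mem _ hp hq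
  | add p q hp hq => rw [map_add]; exact Subalgebra.add_mem _ hp hq

/-- The subalgebra generated by the `x_i` and the `c_i`. -/
def xcAlg : Subalgebra ℂ (AHC u M E) :=
  Algebra.adjoin ℂ (Set.range (x u M E) ∪ Set.range (c u M E))

theorem x_mem (i : Fin n) : x u M E i ∈ xcAlg u M E :=
  Algebra.subset_adjoin (Or.inl ⟨i, rfl⟩)

theorem c_mem (i : Fin n) : c u M E i ∈ xcAlg u M E :=
  Algebra.subset_adjoin (Or.inr ⟨i, rfl⟩)

/-- The elements `a` that `s_i` can be moved across: `s_i a = b s_i + d`, where `b` and `d` lie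
in the subalgebra generated by the `x_i` and the `c_i`. -/
def Exchange (i : Fin n) (a : AHC u M E) : Prop :=
  ∃ b ∈ xcAlg u M E, ∃ d ∈ xcAlg u M E, s u M E i * a = b * s u M E i + d

variable {u M E}

/-- Closure under products comes from `s (p q) = (b s + d) q = b b' s + (b d' + d q)`, so the
generators suffice. -/
theorem Exchange.of_mem {i : Fin n} (hx : ∀ k, Exchange u M E i (x u M E k))
    (hc : ∀ k, Exchange u M E i (c u M E k)) {a : AHC u M E} (ha : a ∈ xcAlg u M E) :
    Exchange u M E i a := by
  induction ha using Algebra.adjoin_induction with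
  | mem g hg =>
    obtain ⟨k, rfl⟩ | ⟨k, rfl⟩ := hg
    · exact hx k
    · exact hc k
  | algebraMap r =>
    exact ⟨_, Subalgebra.algebraMap_mem _ r, 0, Subalgebra.zero_mem _, by
      rw [add_zero, Algebra.commutes]⟩
  | add p q _ _ hp hq =>
    obtain ⟨b, hb, d, hd, h⟩ := hp
    obtain ⟨b', hb', d', hd', h'⟩ := hq
    refine ⟨b + b', Subalgebra.add_mem _ hb hb', d + d', Subalgebra.add_mem _ hd hd', ?_⟩
    rw [mul_add, h, h']
    noncomm_ring
  | mul p q _ hqm hp hq =>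
    obtain ⟨b, hb, d, hd, h⟩ := hp
    obtain ⟨b', hb', d', hd', h'⟩ := hq
    refine ⟨b * b', Subalgebra.mul_mem _ hb hb', b * d' + d * q,
      Subalgebra.add_mem _ (Subalgebra.mul_mem _ hb hd') (Subalgebra.mul_mem _ hd hqm), ?_⟩
    rw [← mul_assoc, h, add_mul, mul_assoc, h']
    noncomm_ring

theorem x_mul_xPow (i : Fin n) (α : Fin n →₀ ℕ) :
    x u M E i * xPow u M E α = xPow u M E (Finsupp.single i 1 + α) := by
  have h : xPow u M E (Finsupp.single i 1) = x u M E i := by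
    rw [xPow, ← prod_ofFn_ite (x u M E) i]
    congr 2
    ext k
    rw [Finsupp.single_apply]
    split_ifs <;> simp
  rw [← h, ← polyHom_monomial, ← polyHom_monomial, ← polyHom_monomial, ← map_mul,
    MvPolynomial.monomial_mul, one_mul]

theorem c_mul_xPow (i : Fin n) (α : Fin n →₀ ℕ) :
    c u M E i * xPow u M E α = xPow u M E α * c u M E i ∨
      c u M E i * xPow u M E α = -(xPow u M E α * c u M E i) := by
  refine list_prod_comm_or_anticomm _ _ ?_
  intro y hy
  obtain ⟨k, rfl⟩ := (List.mem_ofFn' _ _).1 hy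
  rcases eq_or_ne k i with rfl | hk
  · refine pow_comm_or_anticomm (Or.inr ?_) _
    rw [x_c_same, neg_neg]
  · exact pow_comm_or_anticomm (Or.inl (x_c_ne u M E hk).symm) _

variable (u M E) in
-- The span is stable under left multiplication: `x_i` raises an exponent, and `c_i` passes `x^α` up
-- to sign before being absorbed into `c^ε`.
theorem xcAlg_le_span : (xcAlg u M E).toSubmodule ≤ Submodule.span ℂ
    (Set.range fun p : (Fin n →₀ ℕ) × (Fin n → ZMod 2) ↦ xPow u M E p.1 * cPow u M E p.2) := by
  intro a ha
  have h1 : 1 ∈ Submodule.span ℂ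
      (Set.range fun p : (Fin n →₀ ℕ) × (Fin n → ZMod 2) ↦ xPow u M E p.1 * cPow u M E p.2) :=
    Submodule.subset_span ⟨(0, 0), by simp [xPow_zero, cPow_zero]⟩
  refine mem_of_mem_adjoin h1 ?_ ha
  rintro _ (⟨i, rfl⟩ | ⟨i, rfl⟩) y hy
  all_goals
    induction hy using Submodule.span_induction with
    | zero => simp
    | add p q _ _ hp hq => rw [mul_add]; exact Submodule.add_mem _ hp hq
    | smul r p _ hp => rw [mul_smul_comm]; exact Submodule.smul_mem _ r hp
    | mem y hy => ?_
  · obtain ⟨⟨α, ε⟩, rfl⟩ := hy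
    beta_reduce
    rw [← mul_assoc, x_mul_xPow]
    exact Submodule.subset_span ⟨(_, ε), rfl⟩
  · obtain ⟨⟨α, ε⟩, rfl⟩ := hy
    beta_reduce
    have h : ∀ ε' : Fin n → ZMod 2, xPow u M E α * cPow u M E ε' ∈ Submodule.span ℂ
        (Set.range fun p : (Fin n →₀ ℕ) × (Fin n → ZMod 2) ↦
          xPow u M E p.1 * cPow u M E p.2) := fun ε' ↦ Submodule.subset_span ⟨(α, ε'), rfl⟩
    obtain ⟨ε', hc⟩ := mul_ofFn_pow (c u M E) (c_mul_self u M E)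
      (fun _ _ ↦ c_mul_c u M E) i ε
    change c u M E i * cPow u M E ε = cPow u M E ε' ∨
      c u M E i * cPow u M E ε = -cPow u M E ε' at hc
    exact mul_mul_mem_of_anticomm (c_mul_xPow i α) hc (h ε')

variable (u M E) in
theorem weylHom_simple (i : Fin n) : weylHom u M E (M.toCoxeterSystem.simple i) = s u M E i :=
  M.toCoxeterSystem.lift_apply_simple (s_pow u M E) i

theorem span_pbwMonomial (hx : ∀ i k, Exchange u M E i (x u M E k))
    (hc : ∀ i k, Exchange u M E i (c u M E k)) :
    ⊤ ≤ Submodule.span ℂ (Set.range (pbwMonomial u M E)) := by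
  have h1 : ∀ w, ∀ a ∈ xcAlg u M E,
      a * weylHom u M E w ∈ Submodule.span ℂ (Set.range (pbwMonomial u M E)) := by
    intro w a ha
    replace ha := xcAlg_le_span u M E ha
    induction ha using Submodule.span_induction with
    | zero => simp
    | add p q _ _ hp hq => rw [add_mul]; exact Submodule.add_mem _ hp hq
    | smul r p _ hp => rw [smul_mul_assoc]; exact Submodule.smul_mem _ r hp
    | mem y hy =>
      obtain ⟨⟨α, ε⟩, rfl⟩ := hy
      exact Submodule.subset_span ⟨(α, ε, w), rfl⟩
  -- The span of all `a w` is a left ideal: stability under `x_i` and `c_i` is immediate, and `s_i a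
  -- w = b (s_i w) + d w`.
  set S := Submodule.span ℂ {y | ∃ a ∈ xcAlg u M E, ∃ w, y = a * weylHom u M E w} with hS
  have h2 : S ≤ Submodule.span ℂ (Set.range (pbwMonomial u M E)) := by
    rw [hS, Submodule.span_le]
    rintro _ ⟨a, ha, w, rfl⟩
    exact h1 w a ha
  refine le_trans ?_ h2
  rintro a -
  have ha : a ∈ Algebra.adjoin ℂ (Set.range (x u M E) ∪ Set.range (c u M E) ∪
    Set.range (s u M E)) := by rw [adjoin_x_c_s]; trivial
  have hmem : ∀ a ∈ xcAlg u M E, ∀ w, a * weylHom u M E w ∈ S := fun a ha w ↦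
    Submodule.subset_span ⟨a, ha, w, rfl⟩
  refine mem_of_mem_adjoin (by simpa using hmem 1 (Subalgebra.one_mem _) 1) ?_ ha
  intro g hg y hy
  induction hy using Submodule.span_induction with
  | zero => simp
  | add p q _ _ hp hq => rw [mul_add]; exact Submodule.add_mem _ hp hq
  | smul r p _ hp => rw [mul_smul_comm]; exact Submodule.smul_mem _ r hp
  | mem y hy =>
    obtain ⟨a, ha, w, rfl⟩ := hy
    rcases hg with hg | ⟨i, rfl⟩
    · rw [← mul_assoc]
      exact hmem _ (Subalgebra.mul_mem _ (Algebra.subset_adjoin hg) ha) w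
    · obtain ⟨b, hb, d, hd, h⟩ := Exchange.of_mem (hx i) (hc i) ha
      rw [← mul_assoc, h, add_mul, mul_assoc, ← weylHom_simple, ← map_mul]
      exact Submodule.add_mem _ (hmem b hb _) (hmem d hd w)

theorem exchange_of_eq_add {i : Fin n} {a b d : AHC u M E} (hb : b ∈ xcAlg u M E)
    (hd : d ∈ xcAlg u M E) (h : s u M E i * a = b * s u M E i + d) : Exchange u M E i a :=
  ⟨b, hb, d, hd, h⟩

/-- Conjugating the exchange relation `s_i a = b s_i + d` by `s_i`. -/
theorem exchange_conj {i : Fin n} {a b d d' : AHC u M E} (ha : a ∈ xcAlg u M E)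
    (hd' : d' ∈ xcAlg u M E) (h : s u M E i * a = b * s u M E i + d)
    (h' : s u M E i * d = d' * s u M E i) : Exchange u M E i b := by
  refine ⟨a, ha, -d', neg_mem hd', ?_⟩
  have hs := s_mul_self u M E i
  calc s u M E i * b = s u M E i * b * (s u M E i * s u M E i) := by rw [hs, mul_one]
    _ = s u M E i * (b * s u M E i + d) * s u M E i - s u M E i * d * s u M E i := by
      noncomm_ring
    _ = (s u M E i * s u M E i) * a * s u M E i - d' * (s u M E i * s u M E i) := by
      rw [← h, h']; noncomm_ring
    _ = a * s u M E i + -d' := by rw [hs]; noncomm_ring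

theorem exchange_of_comm {i : Fin n} {a b : AHC u M E} (hb : b ∈ xcAlg u M E)
    (h : s u M E i * a = b * s u M E i) : Exchange u M E i a :=
  ⟨b, hb, 0, Subalgebra.zero_mem _, by rw [h, add_zero]⟩

theorem exchange_c_of_succ (i k : Fin n) (hk : (k : ℕ) = i + 1) (j : Fin n) :
    Exchange u M E i (c u M E j) :=
  exchange_of_comm (c_mem u M E _) (s_c u M E i k hk j)

/-- The presentation moves `s_i` past `x_i` only; the rule for `x_k`, with `k = i + 1`, follows on
conjugating by the involution `s_i`. -/
theorem exchange_x_of_succ (i k : Fin n) (hk : (k : ℕ) = i + 1) (j : Fin n) :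
    Exchange u M E i (x u M E j) := by
  have h : s u M E i * x u M E i =
      x u M E k * s u M E i + -(u • (1 - c u M E k * c u M E i)) := by
    rw [← x_s u M E i k hk]; abel
  have hcc : ∀ p q, u • (1 - c u M E p * c u M E q) ∈ xcAlg u M E := fun p q ↦
    Subalgebra.smul_mem _ (sub_mem (Subalgebra.one_mem _)
      (mul_mem (c_mem u M E _) (c_mem u M E _))) _
  by_cases hi : j = i
  · subst hi
    exact exchange_of_eq_add (x_mem u M E k) (neg_mem (hcc k j)) h
  by_cases hj : j = k
  · subst hj
    refine exchange_conj (x_mem u M E i) (neg_mem (hcc i j)) h ?_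
    have h1 := s_c u M E i j hk j
    have h2 := s_c u M E i j hk i
    rw [Equiv.swap_apply_right] at h1
    rw [Equiv.swap_apply_left] at h2
    exact mul_neg_smul_one_sub h1 h2
  · exact exchange_of_comm (x_mem u M E j) (x_s_comm u M E i k hk j hi hj).symm

end General

/-! ### The algebra of anticommuting generators `c_i` and `z_i`. -/

/-- Names of the generators of the algebra `OddAlg`. -/
inductive OddGen (n : ℕ) : Type
  | c (i : Fin n)
  | z (i : Fin n)

/-- Relations: all generators anticommute, and `c_i ^ 2 = 1`. -/
inductive OddRel : FreeAlgebra ℂ (OddGen n) → FreeAlgebra ℂ (OddGen n) → Prop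
  | c_sq (i : Fin n) : OddRel (FreeAlgebra.ι ℂ (.c i) * FreeAlgebra.ι ℂ (.c i)) 1
  | c_c (i j : Fin n) (h : i ≠ j) : OddRel (FreeAlgebra.ι ℂ (.c i) * FreeAlgebra.ι ℂ (.c j))
      (-(FreeAlgebra.ι ℂ (.c j) * FreeAlgebra.ι ℂ (.c i)))
  | z_z (i j : Fin n) (h : i ≠ j) : OddRel (FreeAlgebra.ι ℂ (.z i) * FreeAlgebra.ι ℂ (.z j))
      (-(FreeAlgebra.ι ℂ (.z j) * FreeAlgebra.ι ℂ (.z i)))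
  | c_z (i j : Fin n) : OddRel (FreeAlgebra.ι ℂ (.c i) * FreeAlgebra.ι ℂ (.z j))
      (-(FreeAlgebra.ι ℂ (.z j) * FreeAlgebra.ι ℂ (.c i)))

variable (n) in
/-- The algebra generated by pairwise anticommuting elements `c_i` and `z_i` with `c_i ^ 2 = 1`.
With `x_i = c_i z_i` it is the subalgebra of the affine Hecke-Clifford algebra generated by the
`x_i` and the `c_i`. -/
def OddAlg : Type := RingQuot (OddRel (n := n))

instance OddAlg.instRing : Ring (OddAlg n) := RingQuot.instRing OddRel

instance : Algebra ℂ (OddAlg n) := inferInstanceAs (Algebra ℂ (RingQuot OddRel))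

/-- The quotient map from the free algebra. -/
def oddMk : FreeAlgebra ℂ (OddGen n) →ₐ[ℂ] OddAlg n := RingQuot.mkAlgHom ℂ OddRel

theorem oddMk_eq {a b : FreeAlgebra ℂ (OddGen n)} (h : OddRel a b) : oddMk a = oddMk b :=
  RingQuot.mkAlgHom_rel ℂ h

/-- The generator `c_i`. -/
def oc (i : Fin n) : OddAlg n := oddMk (FreeAlgebra.ι ℂ (.c i))

/-- The generator `z_i`. -/
def oz (i : Fin n) : OddAlg n := oddMk (FreeAlgebra.ι ℂ (.z i))

theorem oc_mul_self (i : Fin n) : oc i * oc i = 1 := by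
  simpa [oc] using oddMk_eq (OddRel.c_sq i)

theorem oc_mul_oc {i j : Fin n} (h : i ≠ j) : oc i * oc j = -(oc j * oc i) := by
  simpa [oc] using oddMk_eq (OddRel.c_c i j h)

theorem oz_mul_oz {i j : Fin n} (h : i ≠ j) : oz i * oz j = -(oz j * oz i) := by
  simpa [oz] using oddMk_eq (OddRel.z_z i j h)

theorem oc_mul_oz (i j : Fin n) : oc i * oz j = -(oz j * oc i) := by
  simpa [oc, oz] using oddMk_eq (OddRel.c_z i j)

theorem OddAlg.induction {P : OddAlg n → Prop} (hr : ∀ r : ℂ, P (algebraMap ℂ _ r))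
    (hc : ∀ i, P (oc i)) (hz : ∀ i, P (oz i)) (hadd : ∀ p q, P p → P q → P (p + q))
    (hmul : ∀ p q, P p → P q → P (p * q)) (a : OddAlg n) : P a := by
  obtain ⟨a, rfl : oddMk _ = _⟩ := RingQuot.mkAlgHom_surjective ℂ OddRel a
  induction a using FreeAlgebra.induction with
  | grade0 r => rw [AlgHom.commutes]; exact hr r
  | grade1 g =>
    cases g with
    | c i => exact hc i
    | z i => exact hz i
  | mul p q hp hq => rw [map_mul]; exact hmul _ _ hp hq
  | add p q hp hq => rw [map_add]; exact hadd _ _ hp hq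

section Lift

variable {B : Type*} [Ring B] [Algebra ℂ B] (f g : Fin n → B)

/-- The map on free generators sending `c_i` to `f i` and `z_i` to `g i`. -/
def oddGenMap : OddGen n → B
  | .c i => f i
  | .z i => g i

variable (hsq : ∀ i, f i * f i = 1) (hcc : ∀ i j, i ≠ j → f i * f j = -(f j * f i))
  (hzz : ∀ i j, i ≠ j → g i * g j = -(g j * g i)) (hcz : ∀ i j, f i * g j = -(g j * f i))

/-- The universal property of `OddAlg`. -/
def oddLift : OddAlg n →ₐ[ℂ] B :=
  RingQuot.liftAlgHom ℂ ⟨FreeAlgebra.lift ℂ (oddGenMap f g), by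
    intro a b h
    induction h with
    | c_sq i => simpa [oddGenMap] using hsq i
    | c_c i j h => simpa [oddGenMap] using hcc i j h
    | z_z i j h => simpa [oddGenMap] using hzz i j h
    | c_z i j => simpa [oddGenMap] using hcz i j⟩

theorem oddLift_oc (i : Fin n) : oddLift f g hsq hcc hzz hcz (oc i) = f i := by
  refine (RingQuot.liftAlgHom_mkAlgHom_apply ℂ _ _ _).trans ?_
  simp [oddGenMap]

theorem oddLift_oz (i : Fin n) : oddLift f g hsq hcc hzz hcz (oz i) = g i := by
  refine (RingQuot.liftAlgHom_mkAlgHom_apply ℂ _ _ _).trans ?_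
  simp [oddGenMap]

end Lift

attribute [irreducible] OddAlg.instRing

section Ring

variable {B : Type*} [Ring B] {p q p' q' : B}

/-- Applied to `p = c_i`, `q = x_i`, `p' = c_j`, `q' = x_j`: although the `x_i` commute, the
products `c_i x_i` anticommute for distinct indices. -/
theorem mul_mul_mul_anticomm (h : p * p' = -(p' * p)) (hq : q * q' = q' * q)
    (h1 : q * p' = p' * q) (h2 : q' * p = p * q') : p * q * (p' * q') = -(p' * q' * (p * q)) := by
  calc p * q * (p' * q') = p * (q * p') * q' := by noncomm_ring
    _ = p * p' * (q * q') := by rw [h1]; noncomm_ring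
    _ = -(p' * (p * q') * q) := by rw [h, hq]; noncomm_ring
    _ = _ := by rw [← h2]; noncomm_ring

theorem mul_mul_anticomm_of_anticomm (h : q * p = -(p * q)) : p * (p * q) = -(p * q * p) := by
  rw [mul_assoc, h, mul_neg, neg_neg]

theorem mul_mul_anticomm (h : p * p' = -(p' * p)) (h' : q * p = p * q) :
    p * (p' * q) = -(p' * q * p) := by
  rw [mul_assoc, h', ← mul_assoc, h, neg_mul, mul_assoc]

end Ring

/-! ### The polynomial representation and independence of the ordered monomials of `OddAlg`. -/

section PolyRep

variable (n) in
/-- The space of the polynomial representation of `OddAlg`. -/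
abbrev PolySpin : Type := (Fin n → ZMod 2) → MvPolynomial (Fin n) ℂ

/-- Multiplication by the variable `x_i`. -/
def opX (i : Fin n) : Module.End ℂ (PolySpin n) :=
  Algebra.lsmul ℂ ℂ (PolySpin n) (MvPolynomial.X i : MvPolynomial (Fin n) ℂ)

/-- The sign `(-1) ^ #{j < i | ε_j = 1}`. -/
def sgn (i : Fin n) (ε : Fin n → ZMod 2) : ℂ := ∏ j, if j < i ∧ ε j = 1 then -1 else 1

theorem sgn_mul_self (i : Fin n) (ε : Fin n → ZMod 2) : sgn i ε * sgn i ε = 1 := by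
  rw [sgn, ← Finset.prod_mul_distrib]
  exact Finset.prod_eq_one fun j _ ↦ by split_ifs <;> simp

theorem sgn_add_single (i j : Fin n) (ε : Fin n → ZMod 2) :
    sgn i (ε + Pi.single j 1) = (if j < i then -1 else 1) * sgn i ε := by
  have h : ∀ k, (if k < i ∧ (ε + Pi.single j 1 : Fin n → ZMod 2) k = 1 then (-1 : ℂ) else 1) =
      (if j = k then (if k < i then -1 else 1) else 1) * (if k < i ∧ ε k = 1 then -1 else 1) := by
    intro k
    have hz : ∀ z : ZMod 2, z = 0 ∨ z = 1 := by decide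
    rcases eq_or_ne j k with rfl | hk
    · rcases hz (ε j) with h | h
      · simp [h]
      · have h2 : (1 + 1 : ZMod 2) = 0 := rfl
        by_cases hi : j < i <;> simp [h, h2, hi]
    · simp [hk, hk.symm]
  rw [sgn, Finset.prod_congr rfl fun k _ ↦ h k, Finset.prod_mul_distrib,
    Finset.prod_ite_eq Finset.univ j fun k ↦ if k < i then (-1 : ℂ) else 1]
  simp [sgn]

/-- The automorphism of the polynomial ring changing the sign of `x_i`. -/
def flip (i : Fin n) : MvPolynomial (Fin n) ℂ →ₐ[ℂ] MvPolynomial (Fin n) ℂ :=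
  MvPolynomial.aeval fun k ↦ if k = i then -MvPolynomial.X k else MvPolynomial.X k

theorem flip_X (i k : Fin n) : flip i (MvPolynomial.X k) =
    if k = i then -MvPolynomial.X k else MvPolynomial.X k := by
  simp [flip]

theorem flip_comm (i j : Fin n) (p : MvPolynomial (Fin n) ℂ) :
    flip i (flip j p) = flip j (flip i p) := by
  suffices (flip i).comp (flip j) = (flip j).comp (flip i) from AlgHom.congr_fun this p
  ext k
  simp only [AlgHom.comp_apply, flip_X]
  split_ifs <;> simp_all [flip_X]

theorem flip_flip (i : Fin n) (p : MvPolynomial (Fin n) ℂ) : flip i (flip i p) = p := by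
  suffices (flip i).comp (flip i) = AlgHom.id ℂ _ from AlgHom.congr_fun this p
  ext k
  simp only [AlgHom.comp_apply, flip_X]
  split_ifs <;> simp_all [flip_X]

/-- The operator by which `c_i` acts. -/
def opC (i : Fin n) : Module.End ℂ (PolySpin n) where
  toFun f ε := sgn i ε • flip i (f (ε + Pi.single i 1))
  map_add' f g := by ext1 ε; simp
  map_smul' r f := by ext1 ε; simp [smul_comm r]

theorem opC_apply (i : Fin n) (f : PolySpin n) (ε : Fin n → ZMod 2) :
    opC i f ε = sgn i ε • flip i (f (ε + Pi.single i 1)) := rfl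

theorem opX_apply (i : Fin n) (f : PolySpin n) (ε : Fin n → ZMod 2) :
    opX i f ε = MvPolynomial.X i * f ε := rfl

theorem add_single_add_single (i : Fin n) (ε : Fin n → ZMod 2) :
    ε + Pi.single i 1 + Pi.single i 1 = ε := by
  rw [add_assoc, ← Pi.single_add, show (1 + 1 : ZMod 2) = 0 from rfl, Pi.single_zero, add_zero]

theorem opC_mul_self (i : Fin n) : opC i * opC i = 1 := by
  refine LinearMap.ext fun f ↦ funext fun ε ↦ ?_
  rw [Module.End.mul_apply, opC_apply, opC_apply, map_smul, flip_flip, smul_smul, sgn_add_single,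
    add_single_add_single, if_neg (lt_irrefl i), one_mul, sgn_mul_self, one_smul]
  rfl

/-- The sign attached to `i` counts only indices below `i`, so exactly one of the two orders of the
shifts at `i` and `j` picks up an extra `-1`. -/
theorem opC_mul_opC {i j : Fin n} (h : i ≠ j) : opC i * opC j = -(opC j * opC i) := by
  refine LinearMap.ext fun f ↦ funext fun ε ↦ ?_
  simp only [LinearMap.neg_apply, Pi.neg_apply, Module.End.mul_apply, opC_apply, map_smul,
    smul_smul, sgn_add_single]
  rw [flip_comm j i, add_right_comm]
  rcases lt_or_gt_of_ne h with h | h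
  · simp only [h, h.not_gt, if_true, if_false, neg_mul, one_mul, neg_smul,
      mul_comm (sgn i ε)]
  · simp only [h, h.not_gt, if_true, if_false, neg_mul, one_mul, mul_neg, neg_smul,
      mul_comm (sgn i ε), neg_neg]

theorem opX_mul_opX (i j : Fin n) : opX i * opX j = opX j * opX i := by
  rw [opX, opX, ← map_mul, ← map_mul, mul_comm]

theorem opX_mul_opC_same (i : Fin n) : opX i * opC i = -(opC i * opX i) := by
  refine LinearMap.ext fun f ↦ funext fun ε ↦ ?_
  simp [opC_apply, opX_apply, flip_X]

theorem opX_mul_opC {i j : Fin n} (h : i ≠ j) : opX i * opC j = opC j * opX i := by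
  refine LinearMap.ext fun f ↦ funext fun ε ↦ ?_
  simp [opC_apply, opX_apply, flip_X, h]

/-- The polynomial representation of `OddAlg`, with `z_i = c_i x_i`. -/
def polyRep : OddAlg n →ₐ[ℂ] Module.End ℂ (PolySpin n) :=
  oddLift opC (fun i ↦ opC i * opX i) opC_mul_self (fun _ _ ↦ opC_mul_opC)
    (fun i j h ↦ mul_mul_mul_anticomm (opC_mul_opC h) (opX_mul_opX i j) (opX_mul_opC h)
      (opX_mul_opC h.symm))
    (fun i j ↦ by
      rcases eq_or_ne i j with rfl | h
      · exact mul_mul_anticomm_of_anticomm (opX_mul_opC_same i)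
      · exact mul_mul_anticomm (opC_mul_opC h) (opX_mul_opC h.symm))

/-- The element `x_i = c_i z_i`. -/
def ox (i : Fin n) : OddAlg n := oc i * oz i

theorem polyRep_oc (i : Fin n) : polyRep (oc i) = opC i := oddLift_oc ..

theorem polyRep_ox (i : Fin n) : polyRep (ox i) = opX i := by
  rw [ox, map_mul, polyRep_oc, polyRep, oddLift_oz, ← mul_assoc, opC_mul_self, one_mul]

/-- The ordered monomial `x^α c^ε` in `OddAlg`. -/
def oddMonomial (α : Fin n →₀ ℕ) (ε : Fin n → ZMod 2) : OddAlg n :=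
  (List.ofFn fun i ↦ ox i ^ α i).prod * (List.ofFn fun i ↦ oc i ^ (ε i).val).prod

theorem opC_single (i : Fin n) (η : Fin n → ZMod 2) :
    opC i (Pi.single η 1) = sgn i (η + Pi.single i 1) • Pi.single (η + Pi.single i 1) 1 := by
  ext1 ε
  rw [opC_apply, Pi.smul_apply]
  by_cases h : ε = η + Pi.single i 1
  · subst h
    simp [add_single_add_single]
  · have h' : ε + Pi.single i 1 ≠ η := by
      rintro rfl
      exact h (add_single_add_single i ε).symm
    simp [h, h']

theorem sgn_eq (i : Fin n) (ε : Fin n → ZMod 2) : sgn i ε = 1 ∨ sgn i ε = -1 :=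
  mul_self_eq_one_iff.1 (sgn_mul_self i ε)

/-- Each `opC i` moves a constant basis vector to another one up to a sign. Recording the
accumulated sign as a unit is enough for linear independence. -/
theorem list_prod_opC_single (ε : Fin n → ZMod 2) (l : List (Fin n)) :
    ∃ t : ℂˣ, (l.map fun i ↦ opC i ^ (ε i).val).prod (Pi.single 0 1) =
      t • Pi.single (l.map fun i ↦ Pi.single i (ε i)).sum 1 := by
  induction l with
  | nil => exact ⟨1, by simp⟩
  | cons i l ih =>
    obtain ⟨t, ht⟩ := ih
    have hz : ∀ z : ZMod 2, z = 0 ∨ z = 1 := by decide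
    simp only [List.map_cons, List.prod_cons, List.sum_cons, Module.End.mul_apply, ht]
    rcases hz (ε i) with h | h
    · exact ⟨t, by simp [h]⟩
    · have hu : sgn i ((l.map fun i ↦ (Pi.single i (ε i) : Fin n → ZMod 2)).sum +
          Pi.single i 1) ≠ 0 := by
        rcases sgn_eq i ((l.map fun i ↦ (Pi.single i (ε i) : Fin n → ZMod 2)).sum +
          Pi.single i 1) with h | h <;> rw [h] <;> simp
      refine ⟨t * Units.mk0 _ hu, ?_⟩
      rw [h, ZMod.val_one, pow_one, Units.smul_def, map_smul, opC_single, smul_smul,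
        Units.smul_def, Units.val_mul, Units.val_mk0, add_comm (Pi.single i 1)]

/-- Acting on the vacuum vector, `c^ε` selects the component `ε` and `x^α` then multiplies by the
monomial, so distinct pairs reach distinct basis vectors up to units. -/
theorem polyRep_oddMonomial (α : Fin n →₀ ℕ) (ε : Fin n → ZMod 2) :
    ∃ t : ℂˣ, polyRep (oddMonomial α ε) (Pi.single 0 1) =
      t • Pi.single ε (MvPolynomial.monomial α 1) := by
  obtain ⟨t, ht⟩ := list_prod_opC_single ε (List.finRange n)
  have hε : ((List.finRange n).map fun i ↦ (Pi.single i (ε i) : Fin n → ZMod 2)).sum = ε := by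
    rw [← List.ofFn_eq_map, List.sum_ofFn, Finset.univ_sum_single]
  refine ⟨t, ?_⟩
  have hx : polyRep (List.ofFn fun i ↦ ox i ^ α i).prod =
      Algebra.lsmul ℂ ℂ (PolySpin n) (MvPolynomial.monomial α 1 : MvPolynomial (Fin n) ℂ) := by
    rw [map_list_prod, List.map_ofFn]
    have : (MvPolynomial.monomial α (1 : ℂ)) =
        (List.ofFn fun i ↦ (MvPolynomial.X i : MvPolynomial (Fin n) ℂ) ^ α i).prod := by
      rw [List.prod_ofFn, MvPolynomial.monomial_eq, Finsupp.prod_fintype _ _ (by simp)]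
      simp
    rw [this, map_list_prod, List.map_ofFn]
    simp only [Function.comp_def, map_pow, polyRep_ox]
    rfl
  rw [oddMonomial, map_mul, Module.End.mul_apply, hx, map_list_prod, List.map_ofFn]
  simp only [Function.comp_def, map_pow, polyRep_oc]
  rw [List.ofFn_eq_map, ht, hε]
  ext1 ε'
  simp [Units.smul_def, Pi.single_apply]

end PolyRep

/-- The monomials `x^α c^ε ⊗ w` are linearly independent. -/
theorem linearIndependent_single_oddMonomial (G : Type*) :
    LinearIndependent ℂ fun p : (Fin n →₀ ℕ) × (Fin n → ZMod 2) × G ↦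
      Finsupp.single p.2.2 (oddMonomial p.1 p.2.1) := by
  choose t ht using polyRep_oddMonomial (n := n)
  -- Evaluation at the vacuum vector, applied in each group component, turns the family into a
  -- rescaled basis of `G →₀ PolySpin n`.
  let ev : OddAlg n →ₗ[ℂ] PolySpin n :=
    (LinearMap.applyₗ (Pi.single 0 1)) ∘ₗ polyRep.toLinearMap
  refine LinearIndependent.of_comp (Finsupp.mapRange.linearMap ev) ?_
  let b : Module.Basis (Σ _ : G, Σ _ : Fin n → ZMod 2, Fin n →₀ ℕ) ℂ (G →₀ PolySpin n) :=
    Finsupp.basis fun _ ↦ Pi.basis fun _ ↦ MvPolynomial.basisMonomials (Fin n) ℂ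
  have hb := (b.linearIndependent.comp
    (fun p : (Fin n →₀ ℕ) × (Fin n → ZMod 2) × G ↦ ⟨p.2.2, p.2.1, p.1⟩) (by
      rintro ⟨α, ε, w⟩ ⟨α', ε', w'⟩ h
      simp only [Sigma.mk.injEq] at h
      obtain ⟨h1, h2⟩ := h
      subst h1
      obtain ⟨h2, h3⟩ := Sigma.mk.inj (eq_of_heq h2)
      subst h2
      rw [eq_of_heq h3])).units_smul fun p ↦ t p.1 p.2.1
  convert! hb using 1
  ext1 ⟨α, ε, w⟩
  simp only [Function.comp_apply, Finsupp.mapRange.linearMap_apply, Finsupp.mapRange_single,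
    Pi.smul_apply', b, Finsupp.coe_basis, Pi.basis_apply, MvPolynomial.coe_basisMonomials]
  rw [Units.smul_def, Finsupp.smul_single]
  exact congrArg _ (ht α ε)

/-! ### Signed transpositions and their skew derivations. -/

/-- The data of a signed transposition of the indices `a` and `b`, that is the reflection in the
root `e_a - η e_b` with `η = ± 1`, and of a parameter `κ`. -/
structure ReflData (n : ℕ) where
  /-- The first index. -/
  a : Fin n
  /-- The second index. -/
  b : Fin n
  /-- The sign. -/
  η : ℂ
  /-- The parameter. -/
  κ : ℂ
  /-- The sign is a sign. -/
  sq : η * η = 1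

namespace ReflData

variable (r : ReflData n)

/-- The image of `c_k` under the reflection. -/
def actC (k : Fin n) : OddAlg n :=
  if k = r.a then r.η • oc r.b else if k = r.b then r.η • oc r.a else oc k

/-- The Clifford element of the root. -/
def root : OddAlg n := r.κ • (oc r.a - r.η • oc r.b)

/-- The value at `z_k` of the skew derivation attached to the reflection. -/
def derZ (k : Fin n) : OddAlg n := if k = r.a then r.root else if k = r.b then r.root else 0

theorem actC_mul_self (k : Fin n) : r.actC k * r.actC k = 1 := by
  unfold actC
  split_ifs <;> simp [smul_smul, r.sq, oc_mul_self]

theorem smul_mul_smul_anticomm {B : Type*} [Ring B] [Algebra ℂ B] {p q : B}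
    (h : p * q = -(q * p)) (s t : ℂ) : s • p * t • q = -(t • q * s • p) := by
  rw [smul_mul_smul_comm, smul_mul_smul_comm, h, smul_neg, mul_comm]

theorem actC_eq (k : Fin n) : ∃ t : ℂ, r.actC k = t • oc (Equiv.swap r.a r.b k) := by
  unfold actC
  split_ifs with h1 h2
  · exact ⟨r.η, by rw [h1, Equiv.swap_apply_left]⟩
  · exact ⟨r.η, by rw [h2, Equiv.swap_apply_right]⟩
  · exact ⟨1, by rw [Equiv.swap_apply_of_ne_of_ne h1 h2, one_smul]⟩

theorem actC_anticomm {k l : Fin n} (h : k ≠ l) :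
    r.actC k * r.actC l = -(r.actC l * r.actC k) := by
  obtain ⟨s, hs⟩ := r.actC_eq k
  obtain ⟨t, ht⟩ := r.actC_eq l
  rw [hs, ht]
  exact smul_mul_smul_anticomm (oc_mul_oc (by simpa using h)) s t

theorem actC_mul_oz (k l : Fin n) : r.actC k * oz l = -(oz l * r.actC k) := by
  obtain ⟨s, hs⟩ := r.actC_eq k
  rw [hs, smul_mul_assoc, oc_mul_oz, mul_smul_comm, smul_neg]

theorem oz_mul_root (l : Fin n) : oz l * r.root = -(r.root * oz l) := by
  simp only [root, mul_smul_comm, smul_mul_assoc, mul_sub, sub_mul, oc_mul_oz]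
  module

/-- This is the Clifford formula `σ(c) = -ρ c ρ⁻¹` for the reflection in `ρ`, freed of the inverse
since `ρ` may vanish. It is what results from applying the skew derivation to `c_k z_l = -z_l c_k`.
-/
theorem actC_mul_root (k : Fin n) : r.actC k * r.root = -(r.root * oc k) := by
  have h := r.sq
  unfold actC root
  split_ifs with h1 h2
  · subst h1
    simp only [mul_smul_comm, smul_mul_assoc, mul_sub, sub_mul, smul_sub, smul_smul,
      oc_mul_self]
    match_scalars
    · ring
    · linear_combination -r.κ * h
  · subst h2
    simp only [mul_smul_comm, smul_mul_assoc, mul_sub, sub_mul, smul_sub, smul_smul,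
      oc_mul_self, mul_assoc, h]
    module
  · simp only [mul_smul_comm, smul_mul_assoc, mul_sub, sub_mul, oc_mul_oc h1, oc_mul_oc h2]
    module

theorem actC_mul_derZ (k l : Fin n) : r.actC k * r.derZ l = -(r.derZ l * oc k) := by
  unfold derZ
  split_ifs <;> simp [actC_mul_root]

/-- The matrices representing the generators `c_k`. -/
def matC (k : Fin n) : Matrix (Fin 2) (Fin 2) (OddAlg n) := !![r.actC k, 0; 0, oc k]

/-- The matrices representing the generators `z_k`. -/
def matZ (k : Fin n) : Matrix (Fin 2) (Fin 2) (OddAlg n) :=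
  !![oz (Equiv.swap r.a r.b k), r.derZ k; 0, oz k]

/-- This is the compatibility of the skew derivation with `z_k z_l = -z_l z_k`. It holds because the
root anticommutes with every `z` and because `z_a`, `z_b` have the same image. -/
theorem derZ_anticomm {k l : Fin n} (h : k ≠ l) :
    oz (Equiv.swap r.a r.b k) * r.derZ l + r.derZ k * oz l =
      -(oz (Equiv.swap r.a r.b l) * r.derZ k + r.derZ l * oz k) := by
  unfold derZ
  by_cases hka : k = r.a <;> by_cases hkb : k = r.b <;> by_cases hla : l = r.a <;>
    by_cases hlb : l = r.b <;>
    simp_all [oz_mul_root, Equiv.swap_apply_of_ne_of_ne] 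

/-- The upper triangular representation whose diagonal entries are the reflection and the
identity. -/
def mat : OddAlg n →ₐ[ℂ] Matrix (Fin 2) (Fin 2) (OddAlg n) :=
  -- A map `p ↦ !![σ p, D p; 0, p]` is multiplicative exactly when `σ` is multiplicative and `D (p
  -- q) = σ p * D q + D p * q`. The universal property thus builds `σ` and `D` together once the
  -- matrices of the generators satisfy the relations.
  oddLift r.matC r.matZ
    (fun i ↦ by
      rw [matC, Matrix.mul_fin_two, Matrix.one_fin_two]
      simp [actC_mul_self, oc_mul_self])
    (fun i j h ↦ by
      simp [matC, r.actC_anticomm h, oc_mul_oc h])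
    (fun i j h ↦ by
      have h' : Equiv.swap r.a r.b i ≠ Equiv.swap r.a r.b j := by simpa using h
      simp only [matZ, Matrix.mul_fin_two, oz_mul_oz h, oz_mul_oz h', r.derZ_anticomm h]
      simp)
    (fun i j ↦ by
      simp only [matC, matZ, Matrix.mul_fin_two, actC_mul_oz, oc_mul_oz, actC_mul_derZ]
      simp)

theorem mat_oc (k : Fin n) : r.mat (oc k) = r.matC k := oddLift_oc ..

theorem mat_oz (k : Fin n) : r.mat (oz k) = r.matZ k := oddLift_oz ..

/-- Knowing the second row for all `p`, the first row of a matrix product reads off `act_mul` and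
`der_mul`. -/
theorem mat_lower (p : OddAlg n) : r.mat p 1 0 = 0 ∧ r.mat p 1 1 = p := by
  induction p using OddAlg.induction with
  | hr t => rw [AlgHom.commutes]; simp [Matrix.algebraMap_matrix_apply]
  | hc i => simp [mat_oc, matC]
  | hz i => simp [mat_oz, matZ]
  | hadd p q hp hq => simp [hp, hq]
  | hmul p q hp hq => simp [Matrix.mul_apply, Fin.sum_univ_two, hp, hq]

/-- The reflection as a linear endomorphism of `OddAlg`. -/
def act : OddAlg n →ₗ[ℂ] OddAlg n :=
  (Matrix.entryLinearMap ℂ (OddAlg n) 0 0) ∘ₗ r.mat.toLinearMap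

/-- The skew derivation. -/
def der : OddAlg n →ₗ[ℂ] OddAlg n :=
  (Matrix.entryLinearMap ℂ (OddAlg n) 0 1) ∘ₗ r.mat.toLinearMap

theorem act_apply (p : OddAlg n) : r.act p = r.mat p 0 0 := rfl

theorem der_apply (p : OddAlg n) : r.der p = r.mat p 0 1 := rfl

theorem act_one : r.act 1 = 1 := by simp [act_apply]

theorem der_one : r.der 1 = 0 := by simp [der_apply]

theorem act_mul (p q : OddAlg n) : r.act (p * q) = r.act p * r.act q := by
  simp [act_apply, Matrix.mul_apply, Fin.sum_univ_two, r.mat_lower]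

theorem der_mul (p q : OddAlg n) : r.der (p * q) = r.act p * r.der q + r.der p * q := by
  simp [act_apply, der_apply, Matrix.mul_apply, Fin.sum_univ_two, r.mat_lower]

theorem act_oc (k : Fin n) : r.act (oc k) =
    if k = r.a then r.η • oc r.b else if k = r.b then r.η • oc r.a else oc k := by
  simp [act_apply, mat_oc, matC, actC]

theorem der_oc (k : Fin n) : r.der (oc k) = 0 := by
  simp [der_apply, mat_oc, matC]

theorem act_oz (k : Fin n) : r.act (oz k) =
    if k = r.a then oz r.b else if k = r.b then oz r.a else oz k := by
  rw [act_apply, mat_oz, matZ, Equiv.swap_apply_def]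
  split_ifs <;> simp

theorem der_oz (k : Fin n) : r.der (oz k) =
    if k = r.a then r.root else if k = r.b then r.root else 0 := by
  simp [der_apply, mat_oz, matZ, derZ]

variable (n) in
/-- The set of generators of `OddAlg`. -/
def oddGens : Set (OddAlg n) := Set.range oc ∪ Set.range oz

theorem oc_mem_oddGens (i : Fin n) : oc i ∈ oddGens n := Or.inl ⟨i, rfl⟩

theorem oz_mem_oddGens (i : Fin n) : oz i ∈ oddGens n := Or.inr ⟨i, rfl⟩

variable {G : Type*}

/-- A linear endomorphism that twists the generators and kills all `1 ⊗ w` is zero. -/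
theorem eq_zero_of_twist (F : Module.End ℂ (G →₀ OddAlg n))
    (h : ∀ p ∈ oddGens n, ∃ q : OddAlg n, ∀ v : G →₀ OddAlg n, F (p • v) = q • F v)
    (h1 : ∀ w, F (Finsupp.single w 1) = 0) : F = 0 := by
  -- The kernel of `F` is stable under the generators, hence under all of `OddAlg n`, and the
  -- vectors `1 ⊗ w` generate the whole module.
  have key : ∀ p : OddAlg n, ∀ v : G →₀ OddAlg n, F v = 0 → F (p • v) = 0 := by
    intro p
    induction p using OddAlg.induction with
    | hr t => intro v hv; rw [algebraMap_smul, map_smul, hv, smul_zero]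
    | hc i => intro v hv; obtain ⟨q, hq⟩ := h _ (oc_mem_oddGens i); rw [hq, hv, smul_zero]
    | hz i => intro v hv; obtain ⟨q, hq⟩ := h _ (oz_mem_oddGens i); rw [hq, hv, smul_zero]
    | hadd p q hp hq => intro v hv; rw [add_smul, map_add, hp v hv, hq v hv, add_zero]
    | hmul p q hp hq => intro v hv; rw [mul_smul]; exact hp _ (hq v hv)
  ext w p : 2
  simpa using key p _ (h1 w)

variable [Monoid G]

/-- The operator `p ⊗ w ↦ σ(p) ⊗ g w + D(p) ⊗ w`, where `σ` is the reflection and `D` is the skew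
derivation. -/
def op (g : G) : Module.End ℂ (G →₀ OddAlg n) :=
  (Finsupp.lmapDomain (OddAlg n) ℂ (g * ·)) ∘ₗ Finsupp.mapRange.linearMap r.act +
    Finsupp.mapRange.linearMap r.der

theorem op_single (g w : G) (p : OddAlg n) :
    r.op g (Finsupp.single w p) = Finsupp.single (g * w) (r.act p) + Finsupp.single w (r.der p) := by
  simp [op]

theorem op_single_one (g w : G) :
    r.op g (Finsupp.single w 1) = Finsupp.single (g * w) 1 := by
  rw [op_single, act_one, der_one, Finsupp.single_zero, add_zero]

theorem op_smul (g : G) (p : OddAlg n) (v : G →₀ OddAlg n) :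
    r.op g (p • v : G →₀ OddAlg n) = r.act p • r.op g v + r.der p • v := by
  induction v using Finsupp.induction_linear with
  | zero => simp
  | add v v' h h' => simp only [smul_add, map_add, h, h']; abel
  | single w q =>
    simp only [Finsupp.smul_single, smul_eq_mul, op_single, act_mul, der_mul, smul_add,
      Finsupp.single_add]
    abel

theorem act_root : r.act r.root = -r.root := by
  have h := r.sq
  rw [root, map_smul, map_sub, map_smul, act_oc, act_oc]
  by_cases hab : r.b = r.a
  · simp only [hab, if_true]
    match_scalars; linear_combination (-r.κ * h)
  · simp only [hab, if_true, if_false]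
    match_scalars
    · ring
    · linear_combination -r.κ * h

theorem der_root (r' : ReflData n) : r'.der r.root = 0 := by
  simp [root, der_oc]

/-- On generators `σ² = 1`, `D σ = -σ D` and `D² = 0`, so the mixed terms cancel in the expansion of
the square; `D σ = -σ D` on the `z_k` comes from `σ` negating the root. -/
theorem op_mul_self {g : G} (hg : g * g = 1) : r.op g * r.op g = 1 := by
  rw [← sub_eq_zero]
  refine eq_zero_of_twist _ (fun p hp ↦ ⟨p, fun v ↦ ?_⟩) fun w ↦ ?_
  obtain ⟨i, rfl⟩ | ⟨i, rfl⟩ := hp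
  · have h : r.act (r.act (oc i)) = oc i := by
      simp only [act_oc, apply_ite r.act, map_smul]
      split_ifs <;> simp_all [smul_smul, r.sq]
    have h' : r.der (r.act (oc i)) = 0 := by
      simp only [act_oc]
      split_ifs <;> simp [der_oc]
    simp only [LinearMap.sub_apply, Module.End.mul_apply, Module.End.one_apply, op_smul,
      h, h', der_oc, zero_smul, add_zero, smul_sub]
  · have h : r.act (r.act (oz i)) = oz i := by
      simp only [act_oz, apply_ite r.act]
      split_ifs <;> simp_all
    have h' : r.der (r.act (oz i)) = -(r.act (r.der (oz i))) := by
      simp only [act_oz, der_oz]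
      split_ifs <;> simp_all [der_oz, act_root]
    have h'' : r.der (r.der (oz i)) = 0 := by
      simp only [der_oz]
      split_ifs <;> simp [der_root]
    simp only [LinearMap.sub_apply, Module.End.mul_apply, Module.End.one_apply, op_smul, map_add,
      h, h', h'', zero_smul, add_zero, smul_sub, neg_smul]
    abel
  · simp [op_single_one, ← mul_assoc, hg]

end ReflData

/-! ### Braid relations for the operators, reduced to identities on generators. -/

namespace ReflData

variable (n) in
/-- The span of the Clifford generators. -/
def linC : Submodule ℂ (OddAlg n) := Submodule.span ℂ (Set.range oc)

variable (n) in
/-- The span of all generators. -/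
def linG : Submodule ℂ (OddAlg n) := Submodule.span ℂ (oddGens n)

theorem oc_mem_linC (i : Fin n) : oc i ∈ linC n := Submodule.subset_span ⟨i, rfl⟩

theorem oc_mem_linG (i : Fin n) : oc i ∈ linG n := Submodule.subset_span (oc_mem_oddGens i)

theorem oz_mem_linG (i : Fin n) : oz i ∈ linG n := Submodule.subset_span (oz_mem_oddGens i)

variable (r : ReflData n)

theorem root_mem : r.root ∈ linC n :=
  Submodule.smul_mem _ _ (Submodule.sub_mem _ (oc_mem_linC _)
    (Submodule.smul_mem _ _ (oc_mem_linC _)))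

theorem act_mem_linC {p : OddAlg n} (hp : p ∈ linC n) : r.act p ∈ linC n := by
  refine (Submodule.span_le (p := (linC n).comap r.act)).2 ?_ hp
  rintro _ ⟨i, rfl⟩
  change r.act (oc i) ∈ linC n
  rw [act_oc]
  split_ifs <;> simp [Submodule.smul_mem, oc_mem_linC]

theorem der_of_mem_linC {p : OddAlg n} (hp : p ∈ linC n) : r.der p = 0 := by
  refine (Submodule.span_le (p := LinearMap.ker r.der)).2 ?_ hp
  rintro _ ⟨i, rfl⟩
  exact r.der_oc i

theorem act_mem_linG {p : OddAlg n} (hp : p ∈ linG n) : r.act p ∈ linG n := by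
  refine (Submodule.span_le (p := (linG n).comap r.act)).2 ?_ hp
  rintro _ (⟨i, rfl⟩ | ⟨i, rfl⟩)
  · change r.act (oc i) ∈ linG n
    rw [act_oc]
    split_ifs <;> simp [Submodule.smul_mem, oc_mem_linG]
  · change r.act (oz i) ∈ linG n
    rw [act_oz]
    split_ifs <;> simp [oz_mem_linG]

/-- With `der_of_mem_linC` and the stability of `linC` under reflections, this kills every word
containing two derivations on the span of the generators. -/
theorem der_mem {p : OddAlg n} (hp : p ∈ linG n) : r.der p ∈ linC n := by
  refine (Submodule.span_le (p := (linC n).comap r.der)).2 ?_ hp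
  rintro _ (⟨i, rfl⟩ | ⟨i, rfl⟩)
  · change r.der (oc i) ∈ linC n
    rw [der_oc]
    exact Submodule.zero_mem _
  · change r.der (oz i) ∈ linC n
    rw [der_oz]
    split_ifs <;> simp [root_mem]

variable {r} {r' : ReflData n} {G : Type*} [Monoid G] {g g' : G}

theorem op_comm (hg : g * g' = g' * g)
    (h0 : ∀ p ∈ oddGens n, r.act (r'.act p) = r'.act (r.act p))
    (h1 : ∀ p ∈ oddGens n, r.der (r'.act p) = r'.act (r.der p))
    (h2 : ∀ p ∈ oddGens n, r'.der (r.act p) = r.act (r'.der p)) :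
    r.op g * r'.op g' = r'.op g' * r.op g := by
  rw [← sub_eq_zero]
  refine eq_zero_of_twist _ (fun p hp ↦ ⟨r.act (r'.act p), fun v ↦ ?_⟩) fun w ↦ ?_
  · have hG : p ∈ linG n := Submodule.subset_span hp
    have e1 : r.der (r'.der p) = 0 := der_of_mem_linC _ (der_mem _ hG)
    have e2 : r'.der (r.der p) = 0 := der_of_mem_linC _ (der_mem _ hG)
    simp only [LinearMap.sub_apply, Module.End.mul_apply, op_smul, map_add, h1 p hp, h2 p hp,
      ← h0 p hp, e1, e2, zero_smul, smul_sub]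
    abel
  · simp only [LinearMap.sub_apply, Module.End.mul_apply, op_single_one, ← mul_assoc, hg, sub_self]

/-- Both sides are expanded on `p • v`, and only terms with at most one derivation survive. Writing
`r`, `r'` for the operators, `h0` matches the terms without derivation, `h1` the coefficients of `r'
r v`, `h2` those of `r r' v`, and `h3` those of `r r v` and `r' r' v`, both equal to `v`. -/
theorem op_braid_three (hg : g * g' * g = g' * g * g') (hgg : g * g = 1) (hgg' : g' * g' = 1)
    (h0 : ∀ p ∈ oddGens n, r.act (r'.act (r.act p)) = r'.act (r.act (r'.act p)))
    (h1 : ∀ p ∈ oddGens n, r.der (r'.act (r.act p)) = r'.act (r.act (r'.der p)))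
    (h2 : ∀ p ∈ oddGens n, r'.der (r.act (r'.act p)) = r.act (r'.act (r.der p)))
    (h3 : ∀ p ∈ oddGens n, r.act (r'.der (r.act p)) = r'.act (r.der (r'.act p))) :
    r.op g * r'.op g' * r.op g = r'.op g' * r.op g * r'.op g' := by
  have hs : ∀ v, r.op g (r.op g v) = v := LinearMap.congr_fun (r.op_mul_self hgg)
  have hs' : ∀ v, r'.op g' (r'.op g' v) = v := LinearMap.congr_fun (r'.op_mul_self hgg')
  rw [← sub_eq_zero]
  refine eq_zero_of_twist _ (fun p hp ↦ ⟨r.act (r'.act (r.act p)), fun v ↦ ?_⟩) fun w ↦ ?_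
  · have hG : p ∈ linG n := Submodule.subset_span hp
    have ha := r.act_mem_linG hG
    have ha' := r'.act_mem_linG hG
    have hd := r.der_mem hG
    have hd' := r'.der_mem hG
    have e1 := der_of_mem_linC r (der_mem r' ha)
    have e2 := der_of_mem_linC r' (der_mem r ha')
    have e3 := der_of_mem_linC r' hd
    have e4 := der_of_mem_linC r hd'
    have e5 := der_of_mem_linC r (act_mem_linC r' hd)
    have e6 := der_of_mem_linC r' (act_mem_linC r hd')
    simp only [LinearMap.sub_apply, Module.End.mul_apply, op_smul, map_add, h1 p hp, h2 p hp,
      h3 p hp, ← h0 p hp, e1, e2, e3, e4, e5, e6, hs, hs', zero_smul, smul_sub, add_zero]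
    abel
  · simp only [LinearMap.sub_apply, Module.End.mul_apply, op_single_one, ← mul_assoc, hg, sub_self]

/-- The same expansion: `h1` and `h2` compare the coefficients of the alternating words of length
three. In `h3` and `h4` the derivation sits at an inner letter, and deleting that letter leaves a
square, so the remaining word shortens to `r' v` and `r v` respectively. -/
theorem op_braid_four (hg : g * g' * g * g' = g' * g * g' * g) (hgg : g * g = 1)
    (hgg' : g' * g' = 1)
    (h0 : ∀ p ∈ oddGens n,
      r.act (r'.act (r.act (r'.act p))) = r'.act (r.act (r'.act (r.act p))))
    (h1 : ∀ p ∈ oddGens n,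
      r.der (r'.act (r.act (r'.act p))) = r'.act (r.act (r'.act (r.der p))))
    (h2 : ∀ p ∈ oddGens n,
      r'.der (r.act (r'.act (r.act p))) = r.act (r'.act (r.act (r'.der p))))
    (h3 : ∀ p ∈ oddGens n,
      r.act (r'.der (r.act (r'.act p))) = r'.act (r.act (r'.der (r.act p))))
    (h4 : ∀ p ∈ oddGens n,
      r'.act (r.der (r'.act (r.act p))) = r.act (r'.act (r.der (r'.act p)))) :
    r.op g * r'.op g' * r.op g * r'.op g' = r'.op g' * r.op g * r'.op g' * r.op g := by
  have hs : ∀ v, r.op g (r.op g v) = v := LinearMap.congr_fun (r.op_mul_self hgg)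
  have hs' : ∀ v, r'.op g' (r'.op g' v) = v := LinearMap.congr_fun (r'.op_mul_self hgg')
  rw [← sub_eq_zero]
  refine eq_zero_of_twist _ (fun p hp ↦ ⟨r.act (r'.act (r.act (r'.act p))), fun v ↦ ?_⟩) fun w ↦ ?_
  · have hG : p ∈ linG n := Submodule.subset_span hp
    have ha := r.act_mem_linG hG
    have ha' := r'.act_mem_linG hG
    have haa := r'.act_mem_linG ha
    have haa' := r.act_mem_linG ha'
    have hd := r.der_mem hG
    have hd' := r'.der_mem hG
    have had := r'.act_mem_linC hd
    have had' := r.act_mem_linC hd'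
    have hda := r'.der_mem ha
    have hda' := r.der_mem ha'
    have e1 := der_of_mem_linC r hda
    have e2 := der_of_mem_linC r' hda'
    have e3 := der_of_mem_linC r' hd
    have e4 := der_of_mem_linC r hd'
    have e5 := der_of_mem_linC r had
    have e6 := der_of_mem_linC r' had'
    have e7 := der_of_mem_linC r' (act_mem_linC r had)
    have e8 := der_of_mem_linC r (act_mem_linC r' had')
    have e9 := der_of_mem_linC r (der_mem r' haa')
    have e10 := der_of_mem_linC r' (der_mem r haa)
    have e11 := der_of_mem_linC r (act_mem_linC r' hda')
    have e12 := der_of_mem_linC r' (act_mem_linC r hda)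
    simp only [LinearMap.sub_apply, Module.End.mul_apply, op_smul, map_add, h1 p hp, h2 p hp,
      h3 p hp, h4 p hp, ← h0 p hp, e1, e2, e3, e4, e5, e6, e7, e8, e9, e10, e11, e12, hs, hs',
      zero_smul, smul_sub, add_zero]
    abel
  · simp only [LinearMap.sub_apply, Module.End.mul_apply, op_single_one, ← mul_assoc, hg, sub_self]

/-- Reflections with disjoint supports commute. -/
theorem op_comm_of_disjoint (hg : g * g' = g' * g) (h1 : r.a ≠ r'.a) (h2 : r.a ≠ r'.b)
    (h3 : r.b ≠ r'.a) (h4 : r.b ≠ r'.b) : r.op g * r'.op g' = r'.op g' * r.op g := by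
  have h1' := h1.symm
  have h2' := h2.symm
  have h3' := h3.symm
  have h4' := h4.symm
  refine op_comm hg ?_ ?_ ?_ <;> rintro _ (⟨i, rfl⟩ | ⟨i, rfl⟩) <;>
    simp only [act_oc, act_oz, der_oc, der_oz, root] <;>
    split_ifs <;>
    simp_all [act_oc, act_oz, der_oc, der_oz, root]

/-- The reflections in `e_a - e_b` and `e_a + e_b` commute. -/
theorem op_comm_of_neg (hg : g * g' = g' * g) (ha : r'.a = r.a) (hb : r'.b = r.b)
    (hab : r.a ≠ r.b) (hη : r.η = 1) (hη' : r'.η = -1) :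
    r.op g * r'.op g' = r'.op g' * r.op g := by
  have hab' := hab.symm
  refine op_comm hg ?_ ?_ ?_ <;> rintro _ (⟨i, rfl⟩ | ⟨i, rfl⟩) <;>
    simp only [act_oc, act_oz, der_oc, der_oz, root, ha, hb, hη, hη'] <;>
    split_ifs <;>
    simp_all [act_oc, act_oz, der_oc, der_oz, root, add_comm] <;> module

/-- The braid relation of length three. -/
theorem op_braid_three_of_path (hg : g * g' * g = g' * g * g') (hgg : g * g = 1)
    (hgg' : g' * g' = 1) (hb : r'.a = r.b) (hab : r.a ≠ r.b) (hac : r.a ≠ r'.b)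
    (hbc : r.b ≠ r'.b) (hη : r.η = 1) (hκ : r'.κ = r.κ) :
    r.op g * r'.op g' * r.op g = r'.op g' * r.op g * r'.op g' := by
  have hab' := hab.symm
  have hac' := hac.symm
  have hbc' := hbc.symm
  have hsq := r'.sq
  refine op_braid_three hg hgg hgg' ?_ ?_ ?_ ?_ <;> rintro _ (⟨i, rfl⟩ | ⟨i, rfl⟩) <;>
    by_cases hi1 : i = r.a <;> by_cases hi2 : i = r.b <;> by_cases hi3 : i = r'.b <;>
    simp_all [act_oc, act_oz, der_oc, der_oz, root, smul_smul]

/-- The braid relation of length four. -/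
theorem op_braid_four_of_end (hg : g * g' * g * g' = g' * g * g' * g) (hgg : g * g = 1)
    (hgg' : g' * g' = 1) (hb : r'.a = r.b) (hb' : r'.b = r.b) (hab : r.a ≠ r.b)
    (hη : r.η = 1) (hη' : r'.η = -1) :
    r.op g * r'.op g' * r.op g * r'.op g' = r'.op g' * r.op g * r'.op g' * r.op g := by
  have hab' := hab.symm
  refine op_braid_four hg hgg hgg' ?_ ?_ ?_ ?_ ?_ <;> rintro _ (⟨i, rfl⟩ | ⟨i, rfl⟩) <;>
    by_cases hi1 : i = r.a <;> by_cases hi2 : i = r.b <;>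
    simp_all [act_oc, act_oz, der_oc, der_oz, root] <;> module

end ReflData

/-! ### Passing between Coxeter relations `(a b) ^ m = 1` and braid relations. -/

section Braid

theorem comm_of_mul_pow_two {G : Type*} [Group G] {g g' : G} (hg : g * g = 1) (hg' : g' * g' = 1)
    (h : (g * g') ^ 2 = 1) : g * g' = g' * g := by
  refine mul_right_cancel (b := g * g') ?_
  calc g * g' * (g * g') = 1 := by rw [← pow_two, h]
    _ = g' * (g * g) * g' := by rw [hg, mul_one, hg']
    _ = g' * g * (g * g') := by simp only [mul_assoc]

theorem braid_of_mul_pow_three {G : Type*} [Group G] {g g' : G} (hg : g * g = 1)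
    (hg' : g' * g' = 1) (h : (g * g') ^ 3 = 1) : g * g' * g = g' * g * g' := by
  refine mul_right_cancel (b := g' * g * g') ?_
  calc g * g' * g * (g' * g * g') = (g * g') ^ 3 := by
        simp only [pow_succ, pow_zero, one_mul, mul_assoc]
    _ = g' * (g * (g' * g') * g) * g' := by rw [h, hg', mul_one, hg, mul_one, hg']
    _ = g' * g * g' * (g' * g * g') := by simp only [mul_assoc]

theorem braid_of_mul_pow_four {G : Type*} [Group G] {g g' : G} (hg : g * g = 1)
    (hg' : g' * g' = 1) (h : (g * g') ^ 4 = 1) : g * g' * g * g' = g' * g * g' * g := by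
  refine mul_right_cancel (b := g * g' * g * g') ?_
  calc g * g' * g * g' * (g * g' * g * g') = (g * g') ^ 4 := by
        simp only [pow_succ, pow_zero, one_mul, mul_assoc]
    _ = g' * (g * (g' * (g * g) * g') * g) * g' := by
        rw [h, hg, mul_one, hg', mul_one, hg, mul_one, hg']
    _ = g' * g * g' * g * (g * g' * g * g') := by simp only [mul_assoc]

variable {A : Type*} [Monoid A] {a b : A}

theorem mul_pow_two_of_comm (ha : a * a = 1) (hb : b * b = 1) (h : a * b = b * a) :
    (a * b) ^ 2 = 1 := by
  calc (a * b) ^ 2 = a * b * (a * b) := pow_two _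
    _ = b * (a * a) * b := by rw [h]; simp only [mul_assoc, h]
    _ = 1 := by rw [ha, mul_one, hb]

theorem mul_pow_three_of_braid (ha : a * a = 1) (hb : b * b = 1) (h : a * b * a = b * a * b) :
    (a * b) ^ 3 = 1 := by
  calc (a * b) ^ 3 = a * b * a * (b * a * b) := by
        simp only [pow_succ, pow_zero, one_mul, mul_assoc]
    _ = b * (a * (b * b) * a) * b := by rw [h]; simp only [mul_assoc]
    _ = 1 := by rw [hb, mul_one, ha, mul_one, hb]

theorem mul_pow_four_of_braid (ha : a * a = 1) (hb : b * b = 1)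
    (h : a * b * a * b = b * a * b * a) : (a * b) ^ 4 = 1 := by
  calc (a * b) ^ 4 = a * b * a * b * (a * b * a * b) := by
        simp only [pow_succ, pow_zero, one_mul, mul_assoc]
    _ = b * (a * (b * (a * a) * b) * a) * b := by
        nth_rewrite 1 [h]; simp only [mul_assoc]
    _ = 1 := by rw [ha, mul_one, hb, mul_one, ha, mul_one, hb]

end Braid

namespace ReflData

/-- The braid relations for the operators attached to two reflections, given the order `m` of the
product of the corresponding group elements. -/
def BraidRel (r r' : ReflData n) (m : ℕ) : Prop :=
  ∀ (G : Type) [Group G] (g g' : G), g * g = 1 → g' * g' = 1 → (g * g') ^ m = 1 →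
    (r.op g * r'.op g') ^ m = 1 ∧ (r'.op g' * r.op g) ^ m = 1

variable {r r' : ReflData n}

theorem braidRel_of_disjoint (h1 : r.a ≠ r'.a) (h2 : r.a ≠ r'.b)
    (h3 : r.b ≠ r'.a) (h4 : r.b ≠ r'.b) : BraidRel r r' 2 := by
  intro G _ g g' hg hg' h
  have := op_comm_of_disjoint (comm_of_mul_pow_two hg hg' h) h1 h2 h3 h4
  exact ⟨mul_pow_two_of_comm (op_mul_self _ hg) (op_mul_self _ hg') this,
    mul_pow_two_of_comm (op_mul_self _ hg') (op_mul_self _ hg) this.symm⟩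

theorem braidRel_of_neg (ha : r'.a = r.a) (hb : r'.b = r.b)
    (hab : r.a ≠ r.b) (hη : r.η = 1) (hη' : r'.η = -1) : BraidRel r r' 2 := by
  intro G _ g g' hg hg' h
  have := op_comm_of_neg (comm_of_mul_pow_two hg hg' h) ha hb hab hη hη'
  exact ⟨mul_pow_two_of_comm (op_mul_self _ hg) (op_mul_self _ hg') this,
    mul_pow_two_of_comm (op_mul_self _ hg') (op_mul_self _ hg) this.symm⟩

theorem braidRel_of_path (hb : r'.a = r.b) (hab : r.a ≠ r.b) (hac : r.a ≠ r'.b)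
    (hbc : r.b ≠ r'.b) (hη : r.η = 1) (hκ : r'.κ = r.κ) : BraidRel r r' 3 := by
  intro G _ g g' hg hg' h
  have := op_braid_three_of_path (braid_of_mul_pow_three hg hg' h) hg hg' hb hab hac hbc hη hκ
  exact ⟨mul_pow_three_of_braid (op_mul_self _ hg) (op_mul_self _ hg') this,
    mul_pow_three_of_braid (op_mul_self _ hg') (op_mul_self _ hg) this.symm⟩

theorem braidRel_of_end (hb : r'.a = r.b) (hb' : r'.b = r.b) (hab : r.a ≠ r.b)
    (hη : r.η = 1) (hη' : r'.η = -1) : BraidRel r r' 4 := by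
  intro G _ g g' hg hg' h
  have := op_braid_four_of_end (braid_of_mul_pow_four hg hg' h) hg hg' hb hb' hab hη hη'
  exact ⟨mul_pow_four_of_braid (op_mul_self _ hg) (op_mul_self _ hg') this,
    mul_pow_four_of_braid (op_mul_self _ hg') (op_mul_self _ hg) this.symm⟩

variable (r) in
theorem op_mul_lsmul {G : Type*} [Monoid G] (g : G) (p : OddAlg n) :
    r.op g * Algebra.lsmul ℂ ℂ (G →₀ OddAlg n) p =
      Algebra.lsmul ℂ ℂ (G →₀ OddAlg n) (r.act p) * r.op g +
        Algebra.lsmul ℂ ℂ (G →₀ OddAlg n) (r.der p) :=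
  LinearMap.ext fun v ↦ r.op_smul g p v

theorem op_mul_lsmul_add {G : Type*} [Monoid G] (g : G) {p q d : OddAlg n} (hp : r.act p = -q)
    (hd : r.der p = d) :
    r.op g * Algebra.lsmul ℂ ℂ (G →₀ OddAlg n) p + Algebra.lsmul ℂ ℂ (G →₀ OddAlg n) q * r.op g =
      Algebra.lsmul ℂ ℂ (G →₀ OddAlg n) d := by
  refine LinearMap.ext fun v ↦ ?_
  change r.op g (p • v) + q • r.op g v = d • v
  rw [op_smul, hp, hd, neg_smul]
  abel

theorem op_mul_lsmul_eq_neg {G : Type*} [Monoid G] (g : G) {p q : OddAlg n} (hp : r.act p = -q)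
    (hd : r.der p = 0) :
    r.op g * Algebra.lsmul ℂ ℂ (G →₀ OddAlg n) p =
      -(Algebra.lsmul ℂ ℂ (G →₀ OddAlg n) q * r.op g) := by
  refine LinearMap.ext fun v ↦ ?_
  change r.op g (p • v) = -(q • r.op g v)
  rw [op_smul, hp, hd, neg_smul, zero_smul, add_zero]

end ReflData

/-! ### The representation on `M.Group →₀ OddAlg n` and independence of the PBW monomials. -/

section Rep

variable (u : ℂ) (M : CoxeterMatrix (Fin n)) (E : Free n → Free n → Prop)
  (r : Fin n → ReflData n)

/-- The representation space. -/
abbrev RepSpace : Type := M.Group →₀ OddAlg n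

/-- The operators by which the generators act. -/
def genOp : Gen n → Module.End ℂ (RepSpace M)
  | .x i => Algebra.lsmul ℂ ℂ (RepSpace M) (ox i)
  | .c i => Algebra.lsmul ℂ ℂ (RepSpace M) (oc i)
  | .s i => (r i).op (M.simple i)

theorem oz_mul_oc (i j : Fin n) : oz i * oc j = -(oc j * oz i) := by
  rw [oc_mul_oz, neg_neg]

theorem ox_mul_ox (i j : Fin n) : ox i * ox j = ox j * ox i := by
  rcases eq_or_ne i j with rfl | h
  · rfl
  · calc oc i * oz i * (oc j * oz j) = oc i * (oz i * oc j) * oz j := by noncomm_ring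
      _ = -(oc i * oc j * (oz i * oz j)) := by
        rw [oz_mul_oc i j]; noncomm_ring
      _ = -(oc j * (oc i * oz j) * oz i) := by rw [oc_mul_oc h, oz_mul_oz h]; noncomm_ring
      _ = _ := by rw [oc_mul_oz]; simp only [ox]; noncomm_ring

theorem ox_mul_oc_same (i : Fin n) : ox i * oc i = -(oc i * ox i) := by
  rw [ox, mul_assoc, oz_mul_oc i i, mul_neg]

theorem ox_mul_oc {i j : Fin n} (h : i ≠ j) : ox i * oc j = oc j * ox i := by
  rw [ox, mul_assoc, oz_mul_oc i j, mul_neg, ← mul_assoc, ← mul_assoc,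
    oc_mul_oc h, neg_mul, neg_neg]

/-- This product of a reflected `c_k` with a root is the source of the inhomogeneous terms in the
relations between `s_i` and `x_k`. -/
theorem der_ox (r : ReflData n) (k : Fin n) : r.der (ox k) = r.act (oc k) * r.der (oz k) := by
  rw [ox, r.der_mul, r.der_oc, zero_mul, add_zero]

variable {u M E r}

theorem genOp_rel (hA : ∀ i k : Fin n, (k : ℕ) = i + 1 →
      (r i).a = i ∧ (r i).b = k ∧ (r i).η = 1 ∧ (r i).κ = u)
    (hcox : ∀ i j : Fin n, i < j → (r i).BraidRel (r j) (M i j))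
    (hE : ∀ a b, E a b →
      FreeAlgebra.lift ℂ (genOp M r) a = FreeAlgebra.lift ℂ (genOp M r) b)
    {a b : Free n} (h : Rel u M E a b) :
    FreeAlgebra.lift ℂ (genOp M r) a = FreeAlgebra.lift ℂ (genOp M r) b := by
  have hsq : ∀ i, M.simple i * M.simple i = 1 := fun i ↦
    M.toCoxeterSystem.simple_mul_simple_self i
  cases h with
  | coxeter i j =>
    simp only [map_pow, map_mul, FreeAlgebra.lift_ι_apply, map_one, genOp]
    -- `hcox` covers only `i < j`; the opposite order is the second half of `BraidRel`, combined
    -- with the symmetry of `M`.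
    rcases lt_trichotomy i j with h | rfl | h
    · exact (hcox i j h _ _ _ (hsq i) (hsq j) (M.toCoxeterSystem.simple_mul_simple_pow i j)).1
    · rw [M.diagonal, pow_one, ReflData.op_mul_self _ (hsq i)]
    · rw [M.symmetric i j]
      exact (hcox j i h _ _ _ (hsq j) (hsq i) (M.toCoxeterSystem.simple_mul_simple_pow j i)).2
  | c_sq i =>
    simp only [map_mul, FreeAlgebra.lift_ι_apply, map_one, genOp]
    rw [← map_mul, oc_mul_self, map_one]
  | c_anticomm i j h =>
    simp only [map_mul, map_neg, FreeAlgebra.lift_ι_apply, genOp]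
    rw [← map_mul, oc_mul_oc h, map_neg, map_mul]
  | x_comm i j =>
    simp only [map_mul, FreeAlgebra.lift_ι_apply, genOp]
    rw [← map_mul, ox_mul_ox, map_mul]
  | x_c_same i =>
    simp only [map_mul, map_neg, FreeAlgebra.lift_ι_apply, genOp]
    rw [← map_mul, ox_mul_oc_same, map_neg, map_mul]
  | x_c_ne i j h =>
    simp only [map_mul, FreeAlgebra.lift_ι_apply, genOp]
    rw [← map_mul, ox_mul_oc h, map_mul]
  | s_c i k hk j =>
    obtain ⟨h1, h2, h3, h4⟩ := hA i k hk
    have h : (r i).act (oc j) = oc (Equiv.swap i k j) := by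
      rw [ReflData.act_oc, Equiv.swap_apply_def, h1, h2, h3]
      split_ifs <;> simp
    simp only [map_mul, FreeAlgebra.lift_ι_apply, genOp, ReflData.op_mul_lsmul, ReflData.der_oc,
      h, map_zero, add_zero]
  | x_s i k hk =>
    obtain ⟨h1, h2, h3, h4⟩ := hA i k hk
    have hik : i ≠ k := by rintro rfl; omega
    have h : (r i).act (ox i) = ox k := by
      rw [ox, ReflData.act_mul, ReflData.act_oc, ReflData.act_oz, h1, h2, h3]
      simp [ox]
    -- Here `σ(c_i) D(z_i) = c_k * u (c_i - c_k)`, and `c_k ^ 2 = 1` gives the constant term.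
    have h' : (r i).der (ox i) = -(u • (1 - oc k * oc i)) := by
      rw [der_ox, ReflData.act_oc, ReflData.der_oz, ReflData.root, h1, h2, h3, h4]
      simp [mul_sub, oc_mul_self, smul_sub]
    simp only [map_mul, map_sub, map_smul, map_one, FreeAlgebra.lift_ι_apply, genOp,
      ReflData.op_mul_lsmul, h, h', map_neg]
    abel
  | x_s_comm i k hk j hi hj =>
    obtain ⟨h1, h2, h3, h4⟩ := hA i k hk
    have h : (r i).act (ox j) = ox j := by
      rw [ox, ReflData.act_mul, ReflData.act_oc, ReflData.act_oz, h1, h2]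
      simp [hi, hj]
    have h' : (r i).der (ox j) = 0 := by
      rw [der_ox, ReflData.der_oz, h1, h2]
      simp [hi, hj]
    simp only [map_mul, FreeAlgebra.lift_ι_apply, genOp, ReflData.op_mul_lsmul, h, h', map_zero,
      add_zero]
  | extra _ _ h => exact hE _ _ h

/-- Applied to `1 ⊗ 1`, the factor `w` gives `1 ⊗ w` since the derivations kill `1`, and `x^α c^ε`
then acts by left multiplication. The images are the independent vectors of
`linearIndependent_single_oddMonomial`. -/
theorem linearIndependent_pbwMonomial
    (h : ∀ a b : Free n, Rel u M E a b →
      FreeAlgebra.lift ℂ (genOp M r) a = FreeAlgebra.lift ℂ (genOp M r) b) :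
    LinearIndependent ℂ (pbwMonomial u M E) := by
  let Φ : AHC u M E →ₐ[ℂ] Module.End ℂ (RepSpace M) :=
    RingQuot.liftAlgHom ℂ ⟨FreeAlgebra.lift ℂ (genOp M r), h⟩
  have hΦ : ∀ g, Φ (mk u M E (FreeAlgebra.ι ℂ g)) = genOp M r g := fun g ↦
    (RingQuot.liftAlgHom_mkAlgHom_apply ℂ _ _ _).trans (FreeAlgebra.lift_ι_apply _ _)
  have hw : ∀ w, Φ (weylHom u M E w) (Finsupp.single 1 1) = Finsupp.single w 1 := by
    intro w
    induction w using M.toCoxeterSystem.simple_induction_left with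
    | one => simp
    | mul_simple_left w i ih =>
      rw [map_mul, weylHom_simple, map_mul, Module.End.mul_apply, ih, s, hΦ]
      exact ReflData.op_single_one _ _ _
  have hxc : ∀ α ε, Φ (xPow u M E α * cPow u M E ε) =
      Algebra.lsmul ℂ ℂ (RepSpace M) (oddMonomial α ε) := by
    intro α ε
    simp only [xPow, cPow, oddMonomial, map_mul, map_list_prod, List.map_ofFn, Function.comp_def,
      map_pow, x, c, hΦ, genOp]
  refine LinearIndependent.of_comp
    ((LinearMap.applyₗ (Finsupp.single 1 1)) ∘ₗ Φ.toLinearMap) ?_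
  convert! linearIndependent_single_oddMonomial M.Group (n := n) using 1
  ext1 ⟨α, ε, w⟩
  change Φ (pbwMonomial u M E (α, ε, w)) (Finsupp.single 1 1) = _
  rw [pbwMonomial, map_mul, Module.End.mul_apply, hw, hxc]
  simp

end Rep

/-! ### Types `D_n` and `B_n`: the last generator. -/

section Ring

variable {A : Type*} [Ring A] {r a b d : A}

theorem mul_eq_neg_of_mul_eq_neg (hr : r * r = 1) (h : r * a = -(b * r)) : r * b = -(a * r) := by
  calc r * b = r * (b * r) * r := by rw [mul_assoc, mul_assoc, hr, mul_one]
    _ = -(r * (r * a) * r) := by rw [h]; noncomm_ring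
    _ = -(a * r) := by rw [← mul_assoc r, hr, one_mul]

theorem mul_neg_smul_one_add [Algebra ℂ A] {u : ℂ} (h : r * a = -(b * r))
    (h' : r * b = -(a * r)) : r * -(u • (1 + b * a)) = -(u • (1 + a * b)) * r := by
  rw [mul_neg, mul_smul_comm, mul_add, ← mul_assoc, h', neg_mul, mul_assoc, h]
  simp only [neg_mul, smul_mul_assoc, add_mul, mul_assoc, one_mul, mul_one, mul_neg, neg_neg]

theorem mul_eq_neg_mul_of_eq_neg (h : r * a = -(b * r)) : r * a = -b * r := by
  rw [h, neg_mul]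

theorem mul_eq_neg_mul_add_of_add_eq (h : r * a + b * r = d) : r * a = -b * r + d := by
  rw [← h, neg_mul]; abel

theorem mul_eq_of_mul_neg_eq (h : r * -a = b * r + d) : r * a = -b * r + -d := by
  rw [neg_mul, ← neg_add, ← h, mul_neg, neg_neg]

end Ring

theorem Exchange.neg {u : ℂ} {M : CoxeterMatrix (Fin n)} {E : Free n → Free n → Prop} {i : Fin n}
    {a : AHC u M E} (h : Exchange u M E i (-a)) : Exchange u M E i a := by
  obtain ⟨b, hb, d, hd, h⟩ := h
  exact ⟨-b, neg_mem hb, -d, neg_mem hd, mul_eq_of_mul_neg_eq h⟩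

/-- The reflection data of type `D_n`. -/
def reflD (u : ℂ) (h : 2 ≤ n) (i : Fin n) : ReflData n :=
  if hi : (i : ℕ) + 1 < n then ⟨i, ⟨i + 1, hi⟩, 1, u, one_mul 1⟩
  -- The root is `e_p + e_q` for the last two indices. Taking `p` as first index makes the node `n -
  -- 3`, whose second index is `p`, fit `braidRel_of_path`.
  else ⟨⟨n - 2, by omega⟩, i, -1, u, by norm_num⟩

/-- The reflection data of type `B_n`. -/
def reflB (u v : ℂ) (i : Fin n) : ReflData n :=
  if hi : (i : ℕ) + 1 < n then ⟨i, ⟨i + 1, hi⟩, 1, u, one_mul 1⟩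
  -- With equal indices and sign `-1` the reflection negates `c_i` and fixes `z_i`, and `root` is `2
  -- κ c_i`. The division by `2` makes it `√2 v c_i`, whence `D(x_i) = -√2 v`.
  else ⟨i, i, -1, ((Real.sqrt 2 : ℝ) : ℂ) * v / 2, by norm_num⟩

theorem reflD_of_lt (u : ℂ) (h : 2 ≤ n) {i : Fin n} (hi : (i : ℕ) + 1 < n) :
    reflD u h i = ⟨i, ⟨i + 1, hi⟩, 1, u, one_mul 1⟩ := dif_pos hi

theorem reflD_of_last (u : ℂ) (h : 2 ≤ n) {i : Fin n} (hi : (i : ℕ) + 1 = n) :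
    reflD u h i = ⟨⟨n - 2, by omega⟩, i, -1, u, by norm_num⟩ := dif_neg (by omega)

theorem reflB_of_lt (u v : ℂ) {i : Fin n} (hi : (i : ℕ) + 1 < n) :
    reflB u v i = ⟨i, ⟨i + 1, hi⟩, 1, u, one_mul 1⟩ := dif_pos hi

theorem reflB_of_last (u v : ℂ) {i : Fin n} (hi : (i : ℕ) + 1 = n) :
    reflB u v i = ⟨i, i, -1, ((Real.sqrt 2 : ℝ) : ℂ) * v / 2, by norm_num⟩ := dif_neg (by omega)

theorem braidRel_reflD (u : ℂ) (h : 2 ≤ n) {i j : Fin n} (hij : i < j) :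
    (reflD u h i).BraidRel (reflD u h j) (coxeterD n i j) := by
  have hi : (i : ℕ) + 1 < n := by omega
  have hij' : (i : ℕ) < j := hij
  rw [reflD_of_lt u h hi]
  by_cases hj : (j : ℕ) + 1 < n
  · rw [reflD_of_lt u h hj]
    by_cases hs : (i : ℕ) + 1 = j
    · have hm : coxeterD n i j = 3 := by
        simp only [coxeterD, Matrix.of_apply]
        rw [if_neg hij.ne, if_pos (by omega)]
      rw [hm]
      refine ReflData.braidRel_of_path ?_ ?_ ?_ ?_ rfl rfl <;> simp [Fin.ext_iff] <;> omega
    · have hm : coxeterD n i j = 2 := by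
        simp only [coxeterD, Matrix.of_apply]
        rw [if_neg hij.ne, if_neg (by omega)]
      rw [hm]
      refine ReflData.braidRel_of_disjoint ?_ ?_ ?_ ?_ <;> simp [Fin.ext_iff] <;> omega
  · rw [reflD_of_last u h (i := j) (by omega)]
    by_cases hs : (i : ℕ) + 2 = j
    · have hm : coxeterD n i j = 3 := by
        simp only [coxeterD, Matrix.of_apply]
        rw [if_neg hij.ne, if_pos (by omega)]
      rw [hm]
      refine ReflData.braidRel_of_path ?_ ?_ ?_ ?_ rfl rfl <;> simp [Fin.ext_iff] <;> omega
    · have hm : coxeterD n i j = 2 := by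
        simp only [coxeterD, Matrix.of_apply]
        rw [if_neg hij.ne, if_neg (by omega)]
      rw [hm]
      -- The last two nodes involve the same pair of indices, with the orthogonal roots `e_p - e_q`
      -- and `e_p + e_q`.
      by_cases hs' : (i : ℕ) + 1 = j
      · refine ReflData.braidRel_of_neg ?_ ?_ ?_ rfl rfl <;> simp [Fin.ext_iff] <;> omega
      · refine ReflData.braidRel_of_disjoint ?_ ?_ ?_ ?_ <;> simp [Fin.ext_iff] <;> omega

theorem braidRel_reflB (u v : ℂ) {i j : Fin n} (hij : i < j) :
    (reflB u v i).BraidRel (reflB u v j) (CoxeterMatrix.B n i j) := by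
  have hi : (i : ℕ) + 1 < n := by omega
  have hij' : (i : ℕ) < j := hij
  rw [reflB_of_lt u v hi]
  by_cases hj : (j : ℕ) + 1 < n
  · rw [reflB_of_lt u v hj]
    by_cases hs : (i : ℕ) + 1 = j
    · have hm : CoxeterMatrix.B n i j = 3 := by
        simp only [CoxeterMatrix.B, Matrix.of_apply]
        rw [if_neg hij.ne, if_neg (by omega), if_pos (by omega)]
      rw [hm]
      refine ReflData.braidRel_of_path ?_ ?_ ?_ ?_ rfl rfl <;> simp [Fin.ext_iff] <;> omega
    · have hm : CoxeterMatrix.B n i j = 2 := by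
        simp only [CoxeterMatrix.B, Matrix.of_apply]
        rw [if_neg hij.ne, if_neg (by omega), if_neg (by omega)]
      rw [hm]
      refine ReflData.braidRel_of_disjoint ?_ ?_ ?_ ?_ <;> simp [Fin.ext_iff] <;> omega
  · rw [reflB_of_last u v (i := j) (by omega)]
    by_cases hs : (i : ℕ) + 1 = j
    · have hm : CoxeterMatrix.B n i j = 4 := by
        simp only [CoxeterMatrix.B, Matrix.of_apply]
        rw [if_neg hij.ne, if_pos (by omega)]
      rw [hm]
      refine ReflData.braidRel_of_end ?_ ?_ ?_ rfl rfl <;> simp [Fin.ext_iff] <;> omega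
    · have hm : CoxeterMatrix.B n i j = 2 := by
        simp only [CoxeterMatrix.B, Matrix.of_apply]
        rw [if_neg hij.ne, if_neg (by omega), if_neg (by omega)]
      rw [hm]
      refine ReflData.braidRel_of_disjoint ?_ ?_ ?_ ?_ <;> simp [Fin.ext_iff] <;> omega

theorem genOp_relD (u : ℂ) (h : 2 ≤ n) {a b : Free n} (hab : RelD u a b) :
    FreeAlgebra.lift ℂ (genOp (coxeterD n) (reflD u h)) a =
      FreeAlgebra.lift ℂ (genOp (coxeterD n) (reflD u h)) b := by
  cases hab with
  | s_c_last p q hp hq =>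
    have hpq : q ≠ p := by rintro rfl; omega
    have hp' : p = ⟨n - 2, by omega⟩ := Fin.ext (by simp; omega)
    have e : (reflD u h q).act (oc q) = -oc p := by
      rw [reflD_of_last u h hq, ReflData.act_oc, ← hp']
      simp [hpq]
    simp only [map_mul, map_neg, FreeAlgebra.lift_ι_apply, genOp]
    exact ReflData.op_mul_lsmul_eq_neg _ e (ReflData.der_oc _ _)
  | s_c_ne q i hq hi =>
    have h1 : i ≠ q := by rintro rfl; omega
    have h2 : i ≠ ⟨n - 2, by omega⟩ := by rw [Ne, Fin.ext_iff]; simp; omega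
    have e : (reflD u h q).act (oc i) = oc i := by
      rw [reflD_of_last u h hq, ReflData.act_oc]
      simp [h1, h2]
    simp only [map_mul, FreeAlgebra.lift_ι_apply, genOp, ReflData.op_mul_lsmul,
      ReflData.der_oc, e, map_zero, add_zero]
  | s_x_last p q hp hq =>
    have hpq : q ≠ p := by rintro rfl; omega
    have hp' : p = ⟨n - 2, by omega⟩ := Fin.ext (by simp; omega)
    have e : (reflD u h q).act (ox q) = -ox p := by
      rw [reflD_of_last u h hq, ox, ReflData.act_mul, ReflData.act_oc, ReflData.act_oz, ← hp']
      simp [hpq, ox]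
    have e' : (reflD u h q).der (ox q) = -(u • (1 + oc p * oc q)) := by
      rw [reflD_of_last u h hq, der_ox, ReflData.act_oc, ReflData.der_oz, ReflData.root, ← hp']
      simp [hpq, mul_add, oc_mul_self, add_comm]
    simp only [map_mul, map_neg, map_add, map_smul, map_one, FreeAlgebra.lift_ι_apply, genOp]
    rw [ReflData.op_mul_lsmul_add _ e e']
    simp only [map_mul, map_neg, map_add, map_smul, map_one]
  | s_x_ne q i hq hi =>
    have h1 : i ≠ q := by rintro rfl; omega
    have h2 : i ≠ ⟨n - 2, by omega⟩ := by rw [Ne, Fin.ext_iff]; simp; omega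
    have e : (reflD u h q).act (ox i) = ox i := by
      rw [reflD_of_last u h hq, ox, ReflData.act_mul, ReflData.act_oc, ReflData.act_oz]
      simp [h1, h2]
    have e' : (reflD u h q).der (ox i) = 0 := by
      rw [reflD_of_last u h hq, der_ox, ReflData.der_oz]
      simp [h1, h2]
    simp only [map_mul, FreeAlgebra.lift_ι_apply, genOp, ReflData.op_mul_lsmul,
      e, e', map_zero, add_zero]

theorem genOp_relB (u v : ℂ) {a b : Free n} (hab : RelB v a b) :
    FreeAlgebra.lift ℂ (genOp (CoxeterMatrix.B n) (reflB u v)) a =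
      FreeAlgebra.lift ℂ (genOp (CoxeterMatrix.B n) (reflB u v)) b := by
  cases hab with
  | s_c_last q hq =>
    have e : (reflB u v q).act (oc q) = -oc q := by
      rw [reflB_of_last u v hq, ReflData.act_oc]
      simp
    simp only [map_mul, map_neg, FreeAlgebra.lift_ι_apply, genOp]
    exact ReflData.op_mul_lsmul_eq_neg _ e (ReflData.der_oc _ _)
  | s_c_ne q i hq hi =>
    have e : (reflB u v q).act (oc i) = oc i := by
      rw [reflB_of_last u v hq, ReflData.act_oc]
      simp [hi]
    simp only [map_mul, FreeAlgebra.lift_ι_apply, genOp, ReflData.op_mul_lsmul,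
      ReflData.der_oc, e, map_zero, add_zero]
  | s_x_last q hq =>
    have e : (reflB u v q).act (ox q) = -ox q := by
      rw [reflB_of_last u v hq, ox, ReflData.act_mul, ReflData.act_oc, ReflData.act_oz]
      simp
    have e' : (reflB u v q).der (ox q) =
        algebraMap ℂ (OddAlg n) (-((Real.sqrt 2 : ℝ) : ℂ) * v) := by
      rw [reflB_of_last u v hq, der_ox, ReflData.act_oc, ReflData.der_oz, ReflData.root,
        Algebra.algebraMap_eq_smul_one]
      simp only [if_true, mul_smul_comm, smul_mul_assoc, mul_sub, oc_mul_self]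
      module
    rw [map_add, map_mul, map_mul, FreeAlgebra.lift_ι_apply, FreeAlgebra.lift_ι_apply,
      AlgHom.commutes]
    exact (ReflData.op_mul_lsmul_add _ e e').trans (AlgHom.commutes _ _)
  | s_x_ne q i hq hi =>
    have e : (reflB u v q).act (ox i) = ox i := by
      rw [reflB_of_last u v hq, ox, ReflData.act_mul, ReflData.act_oc, ReflData.act_oz]
      simp [hi]
    have e' : (reflB u v q).der (ox i) = 0 := by
      rw [reflB_of_last u v hq, der_ox, ReflData.der_oz]
      simp [hi]
    simp only [map_mul, FreeAlgebra.lift_ι_apply, genOp, ReflData.op_mul_lsmul,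
      e, e', map_zero, add_zero]

/-- All generators but the last satisfy the type `A` relations and are handled uniformly, so each
type owes only the exchange rules of its last generator, its extra relations and its braid
relations. -/
theorem hasPBW_of_exchange {u : ℂ} {M : CoxeterMatrix (Fin n)} {E : Free n → Free n → Prop}
    {r : Fin n → ReflData n} (hA : ∀ i k : Fin n, (k : ℕ) = i + 1 →
      (r i).a = i ∧ (r i).b = k ∧ (r i).η = 1 ∧ (r i).κ = u)
    (hcox : ∀ i j : Fin n, i < j → (r i).BraidRel (r j) (M i j))
    (hE : ∀ a b, E a b →
      FreeAlgebra.lift ℂ (genOp M r) a = FreeAlgebra.lift ℂ (genOp M r) b)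
    (hx : ∀ i k : Fin n, (i : ℕ) + 1 = n → Exchange u M E i (x u M E k))
    (hc : ∀ i k : Fin n, (i : ℕ) + 1 = n → Exchange u M E i (c u M E k)) :
    HasPBW u M E := by
  refine hasPBW_of_basis u M E
    (linearIndependent_pbwMonomial (r := r) fun a b h ↦ genOp_rel hA hcox hE h)
    (span_pbwMonomial (fun i k ↦ ?_) fun i k ↦ ?_)
  · by_cases hi : (i : ℕ) + 1 < n
    · exact exchange_x_of_succ i ⟨i + 1, hi⟩ rfl k
    · exact hx i k (by omega)
  · by_cases hi : (i : ℕ) + 1 < n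
    · exact exchange_c_of_succ i ⟨i + 1, hi⟩ rfl k
    · exact hc i k (by omega)

theorem hasPBW_D (hn : 2 ≤ n) (u : ℂ) : HasPBW u (coxeterD n) (RelD u) := by
  have hmk : ∀ {a b : Free n}, RelD u a b →
      mk u (coxeterD n) (RelD u) a = mk u (coxeterD n) (RelD u) b :=
    fun h ↦ mk_eq (Rel.extra _ _ h)
  refine hasPBW_of_exchange (r := reflD u hn) (fun i k hk ↦ ?_) (fun i j ↦ braidRel_reflD u hn)
    (fun a b ↦ genOp_relD u hn) (fun q k hq ↦ ?_) fun q k hq ↦ ?_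
  · rw [reflD_of_lt u hn (by omega)]
    exact ⟨rfl, Fin.ext hk.symm, rfl, rfl⟩
  all_goals
    let p : Fin n := ⟨n - 2, by omega⟩
    have hp : (p : ℕ) + 2 = n := by simp only [p]; omega
    have hcq : s u (coxeterD n) (RelD u) q * c _ _ _ q = -(c _ _ _ p * s _ _ _ q) := by
      simpa [s, c] using hmk (RelD.s_c_last p q hp hq)
    -- The presentation states only how `s_q` passes `c_q`; the rule for `c_p` follows because `s_q`
    -- is an involution.
    have hcp := mul_eq_neg_of_mul_eq_neg (s_mul_self _ _ _ q) hcq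
  · have hxq : s u (coxeterD n) (RelD u) q * x _ _ _ q + x _ _ _ p * s _ _ _ q =
        -(u • (1 + c _ _ _ p * c _ _ _ q)) := by
      simpa [s, c, x] using hmk (RelD.s_x_last p q hp hq)
    have hxq' : s u (coxeterD n) (RelD u) q * x _ _ _ q = (-x _ _ _ p) * s _ _ _ q +
        -(u • (1 + c _ _ _ p * c _ _ _ q)) := mul_eq_neg_mul_add_of_add_eq hxq
    have hmem : ∀ i j, -(u • (1 + c u (coxeterD n) (RelD u) i * c _ _ _ j)) ∈ xcAlg _ _ _ :=
      fun i j ↦ neg_mem (Subalgebra.smul_mem _ (add_mem (Subalgebra.one_mem _)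
        (mul_mem (c_mem _ _ _ _) (c_mem _ _ _ _))) _)
    by_cases h1 : k = q
    · subst h1
      exact exchange_of_eq_add (neg_mem (x_mem _ _ _ p)) (hmem _ _) hxq'
    by_cases h2 : k = p
    · subst h2
      -- Since `s_q x_q = (-x_p) s_q + d`, conjugation yields the exchange rule for `-x_p`, and the
      -- sign is then removed.
      exact (exchange_conj (x_mem _ _ _ q) (hmem _ _) hxq' (mul_neg_smul_one_add hcq hcp)).neg
    · refine exchange_of_comm (x_mem _ _ _ k) ?_
      simpa [s, x] using hmk (RelD.s_x_ne q k hq (by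
        rw [Fin.ext_iff] at h1 h2; simp only [p] at h2; omega))
  · by_cases h1 : k = q
    · subst h1
      exact exchange_of_comm (neg_mem (c_mem _ _ _ p)) (mul_eq_neg_mul_of_eq_neg hcq)
    by_cases h2 : k = p
    · subst h2
      exact exchange_of_comm (neg_mem (c_mem _ _ _ q)) (mul_eq_neg_mul_of_eq_neg hcp)
    · refine exchange_of_comm (c_mem _ _ _ k) ?_
      simpa [s, c] using hmk (RelD.s_c_ne q k hq (by
        rw [Fin.ext_iff] at h1 h2; simp only [p] at h2; omega))

theorem hasPBW_B (u v : ℂ) : HasPBW u (CoxeterMatrix.B n) (RelB v) := by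
  have hmk : ∀ {a b : Free n}, RelB v a b →
      mk u (CoxeterMatrix.B n) (RelB v) a = mk u (CoxeterMatrix.B n) (RelB v) b :=
    fun h ↦ mk_eq (Rel.extra _ _ h)
  refine hasPBW_of_exchange (r := reflB u v) (fun i k hk ↦ ?_) (fun i j ↦ braidRel_reflB u v)
    (fun a b ↦ genOp_relB u v) (fun q k hq ↦ ?_) fun q k hq ↦ ?_
  · rw [reflB_of_lt u v (by omega)]
    exact ⟨rfl, Fin.ext hk.symm, rfl, rfl⟩
  · by_cases h1 : k = q
    · subst h1
      have hxq : s u (CoxeterMatrix.B n) (RelB v) k * x _ _ _ k + x _ _ _ k * s _ _ _ k =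
          algebraMap ℂ _ (-((Real.sqrt 2 : ℝ) : ℂ) * v) := by
        have := hmk (RelB.s_x_last k hq)
        rwa [map_add, map_mul, map_mul, AlgHom.commutes] at this
      exact exchange_of_eq_add (neg_mem (x_mem _ _ _ k)) (Subalgebra.algebraMap_mem _ _)
        (mul_eq_neg_mul_add_of_add_eq hxq)
    · refine exchange_of_comm (x_mem _ _ _ k) ?_
      simpa [s, x] using hmk (RelB.s_x_ne q k hq h1)
  · by_cases h1 : k = q
    · subst h1
      refine exchange_of_comm (neg_mem (c_mem _ _ _ k)) (mul_eq_neg_mul_of_eq_neg ?_)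
      simpa [s, c] using hmk (RelB.s_c_last k hq)
    · refine exchange_of_comm (c_mem _ _ _ k) ?_
      simpa [s, c] using hmk (RelB.s_c_ne q k hq h1)

end HeckeClifford

end

/-- The first part is type `D_n`, the second part is type `B_n`. -/
theorem theorem3p6 :
    (∀ (n : ℕ) (_ : 4 ≤ n) (u : ℂ),
      HeckeClifford.HasPBW u (HeckeClifford.coxeterD n) (HeckeClifford.RelD u)) ∧
    (∀ (n : ℕ) (_ : 2 ≤ n) (u v : ℂ),
      HeckeClifford.HasPBW u (CoxeterMatrix.B n) (HeckeClifford.RelB v)) := by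
  exact ⟨fun n hn u ↦ HeckeClifford.hasPBW_D (by omega) u,
    fun n _ u v ↦ HeckeClifford.hasPBW_B u v⟩
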